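/- Let $\beta=\frac{\sqrt{17}-3}{2}$, $h(s)=(s(1-s))^\beta$, $\mathrm B(x,y)=\int_0^1t^{x-1}(1-t)^{y-1}\,dt$, $\gamma=\beta/2+1$, $c=\frac{\sqrt\pi\,\Gamma(2\gamma-1/2)}{2\Gamma(\gamma)\Gamma(\gamma+1/2)^2}$ and $\kappa=\frac{c}{\mathrm B(\beta+1,\beta+1)}$. For $u,v\in[0,1]$ with $0<v-u<1$ and functions $f_0,f_1:[0,1]\to\mathbb R$ put $$G[u,v;f_0,f_1](s)=\begin{cases}(1-(v-u))^\beta f_0\left(\frac{s}{1-(v-u)}\right)&\text{if } s<u,\\ (1-(v-u))^\beta f_0\left(\frac{u}{1-(v-u)}\right)+(v-u)^\beta f_1\left(\frac{s-u}{v-u}\right)&\text{if } u\le s<v,\\ (1-(v-u))^\beta f_0\left(\frac{s-(v-u)}{1-(v-u)}\right)&\text{if } s\ge v.\end{cases}$$ Let $\mathcal T=\bigcup_{n\ge0}\{0,1\}^n$ and let $\{(U_w,V_w):w\in\mathcal T\}$ be independent random vectors, each with density $2\,\mathbf 1\{0\le u\le v\le1\}$ on $[0,1]^2$. For $w\in\mathcal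 T$ set $Z_0^{(w)}=\kappa h$ and, for $n\ge0$, $Z_{n+1}^{(w)}=G[U_w,V_w;Z_n^{(w0)},Z_n^{(w1)}]$, where $w0,w1$ are the two children of $w$. Then, almost surely, the functions $Z_n^{(\varnothing)}$ converge uniformly on $[0,1]$ to a continuous function; let $Z$ be the limit process (set to $0$ where there is no uniform convergence). Say that a random process $X$ with càdlàg paths on $[0,1]$ (right-continuous with left limits), defined on some probability space, satisfies the fixed-point equation in distribution if $$X\ \stackrel{d}{=}\ G[U,V;X^{(0)},X^{(1)}],$$ where $X^{(0)},X^{(1)}$ have the law of $X$, $(U,V)$ has density $2\,\mathbf 1\{0\le u\le v\le 1\}$ on $[0,1]^2$, and $X^{(0)},X^{(1)},(U,V)$ are independent. Then $Z$ is the unique solution in distribution of this equation among all càdlàg processes $X$ on $[0,1]$ with $$\mathbf E[X(\xi)]=\kappa\,\mathrm B(\beta+1,\beta+1)\qquad\text{and}\qquad\mathbf E\big[\|X\|^2\big]<\infty,$$ where $\xi$ is uniform on $[0,1]$ and independent of $X$, and $\|X\|=\sup_{s\in[0,1]}|X(s)|$. That is, $Z$ is such a process and satisfies the equation, and any such process satisfying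 the equation has the same law as $Z$. -/

import Mathlib

open MeasureTheory ProbabilityTheory Filter Topology

noncomputable section

namespace ChordTree

/-- The exponent `β = (√17 - 3) / 2`. -/
def β : ℝ := (Real.sqrt 17 - 3) / 2

/-- The beta function `B(x, y) = ∫₀¹ t ^ (x - 1) (1 - t) ^ (y - 1) dt`. -/
def betaFn (x y : ℝ) : ℝ := ∫ t in (0 : ℝ)..1, t ^ (x - 1) * (1 - t) ^ (y - 1)

/-- `γ = β / 2 + 1`. -/
def γ : ℝ := β / 2 + 1

/-- `c = √π Γ(2γ - 1/2) / (2 Γ(γ) Γ(γ + 1/2) ^ 2) = 1.178226…`. -/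
def c : ℝ :=
  Real.sqrt Real.pi * Real.Gamma (2 * γ - 1 / 2) /
    (2 * Real.Gamma γ * Real.Gamma (γ + 1 / 2) ^ 2)

/-- `κ = c / B(β + 1, β + 1) = 3.34443…`. -/
def κ : ℝ := c / betaFn (β + 1) (β + 1)

/-- Càdlàg functions on `[0, 1]`: right-continuous with left limits. -/
def IsCadlag (f : unitInterval → ℝ) : Prop :=
  (∀ s, ContinuousWithinAt f (Set.Ici s) s) ∧ ∀ s, ∃ l, Tendsto f (𝓝[<] s) (𝓝 l)

/-- The space `D[0, 1]` of càdlàg functions. As a subtype of `[0, 1] → ℝ` it carries the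
σ-algebra generated by the evaluations `f ↦ f s`, which is the Borel σ-algebra of the
Skorokhod topology. -/
abbrev CadlagPath : Type := {f : unitInterval → ℝ // IsCadlag f}

/-- A real number viewed as a point of `[0, 1]` (the identity on `[0, 1]`). -/
def toUnit (x : ℝ) : unitInterval := Set.projIcc 0 1 zero_le_one x

/-- The function of `s` on the right-hand side of the fixed-point equation:
the path `f₀` is cut open at `u` and a copy of `f₁` is inserted on `[u, v)`. -/
def glueFun (u v : unitInterval) (f₀ f₁ : unitInterval → ℝ) (s : unitInterval) : ℝ :=
  if (s : ℝ) < u then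
    (1 - ((v : ℝ) - u)) ^ β * f₀ (toUnit (s / (1 - ((v : ℝ) - u))))
  else if (s : ℝ) < v then
    (1 - ((v : ℝ) - u)) ^ β * f₀ (toUnit (u / (1 - ((v : ℝ) - u)))) +
      ((v : ℝ) - u) ^ β * f₁ (toUnit ((s - u) / ((v : ℝ) - u)))
  else
    (1 - ((v : ℝ) - u)) ^ β * f₀ (toUnit ((s - ((v : ℝ) - u)) / (1 - ((v : ℝ) - u))))

theorem IsCadlag.of_continuous {f : unitInterval → ℝ} (hf : Continuous f) : IsCadlag f :=
  ⟨fun _ => hf.continuousWithinAt,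
    fun s => ⟨f s, hf.continuousAt.mono_left nhdsWithin_le_nhds⟩⟩

theorem IsCadlag.comp_monotone {f : unitInterval → ℝ} (hf : IsCadlag f)
    {φ : unitInterval → unitInterval} (hφ : Monotone φ) (hc : Continuous φ) :
    IsCadlag (fun s => f (φ s)) := by
  refine ⟨fun s => ?_, fun s => ?_⟩
  · exact (hf.1 (φ s)).comp hc.continuousWithinAt (fun t ht => hφ ht)
  · by_cases h : ∃ t, t < s ∧ φ t = φ s
    · obtain ⟨t, hts, he⟩ := h
      refine ⟨f (φ s), ?_⟩
      refine tendsto_const_nhds.congr' ?_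
      filter_upwards [Ioo_mem_nhdsLT hts] with r hr
      have : φ r = φ s := le_antisymm (hφ hr.2.le) (he ▸ hφ hr.1.le)
      rw [this]
    · push Not at h
      obtain ⟨l, hl⟩ := hf.2 (φ s)
      refine ⟨l, hl.comp ?_⟩
      refine tendsto_nhdsWithin_iff.2 ⟨hc.continuousAt.mono_left nhdsWithin_le_nhds, ?_⟩
      filter_upwards [self_mem_nhdsWithin] with r hr
      exact lt_of_le_of_ne (hφ (le_of_lt hr)) (h r hr)

theorem IsCadlag.ite_lt {f g : unitInterval → ℝ} (hf : IsCadlag f) (hg : IsCadlag g)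
    (a : unitInterval) : IsCadlag (fun s => if (s : ℝ) < a then f s else g s) := by
  refine ⟨fun s => ?_, fun s => ?_⟩
  · by_cases h : s < a
    · refine (hf.1 s).congr_of_eventuallyEq ?_ (if_pos h)
      filter_upwards [mem_nhdsWithin_of_mem_nhds (Iio_mem_nhds h)] with r hr
      exact if_pos hr
    · refine (hg.1 s).congr_of_eventuallyEq ?_ (if_neg h)
      filter_upwards [self_mem_nhdsWithin] with r hr
      exact if_neg (not_lt.2 ((not_lt.1 h).trans hr))
  · by_cases h : a < s
    · obtain ⟨l, hl⟩ := hg.2 s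
      refine ⟨l, hl.congr' ?_⟩
      filter_upwards [Ioo_mem_nhdsLT h] with r hr
      exact (if_neg (not_lt.2 hr.1.le)).symm
    · obtain ⟨l, hl⟩ := hf.2 s
      refine ⟨l, hl.congr' ?_⟩
      filter_upwards [self_mem_nhdsWithin] with r hr
      exact (if_pos (lt_of_lt_of_le hr (not_lt.1 h))).symm

theorem IsCadlag.const_add_mul {f : unitInterval → ℝ} (hf : IsCadlag f) (a b : ℝ) :
    IsCadlag (fun s => a + b * f s) :=
  ⟨fun s => ((hf.1 s).const_mul b).const_add a,
    fun s => (hf.2 s).elim fun _ hl => ⟨_, (hl.const_mul b).const_add a⟩⟩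

theorem IsCadlag.affine {f : unitInterval → ℝ} (hf : IsCadlag f) (a : ℝ) {b : ℝ}
    (hb : 0 ≤ b) (m n : ℝ) :
    IsCadlag (fun s => m + n * f (toUnit (((s : ℝ) - a) / b))) := by
  refine IsCadlag.const_add_mul (hf.comp_monotone ?_ ?_) m n
  · intro s t hst
    refine Set.monotone_projIcc _ ?_
    have : (s : ℝ) ≤ t := hst
    gcongr
  · exact continuous_projIcc.comp (by fun_prop)

theorem isCadlag_glueFun (u v : unitInterval) {f₀ f₁ : unitInterval → ℝ}
    (h₀ : IsCadlag f₀) (h₁ : IsCadlag f₁) : IsCadlag (glueFun u v f₀ f₁) := by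
  have hb : 0 ≤ 1 - ((v : ℝ) - u) := by
    have := v.2.2
    have := u.2.1
    linarith
  have e₁ := h₀.affine 0 hb 0 ((1 - ((v : ℝ) - u)) ^ β)
  have e₃ := h₀.affine ((v : ℝ) - u) hb 0 ((1 - ((v : ℝ) - u)) ^ β)
  simp only [zero_add, sub_zero] at e₁ e₃
  by_cases h : (u : ℝ) ≤ v
  · have e₂ := h₁.affine u (sub_nonneg.2 h)
      ((1 - ((v : ℝ) - u)) ^ β * f₀ (toUnit (u / (1 - ((v : ℝ) - u))))) (((v : ℝ) - u) ^ β)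
    exact e₁.ite_lt (e₂.ite_lt e₃ v) u
  · have : glueFun u v f₀ f₁ = fun s : unitInterval => if (s : ℝ) < u then
        (1 - ((v : ℝ) - u)) ^ β * f₀ (toUnit (s / (1 - ((v : ℝ) - u)))) else
        (1 - ((v : ℝ) - u)) ^ β *
          f₀ (toUnit ((s - ((v : ℝ) - u)) / (1 - ((v : ℝ) - u)))) := by
      funext s
      unfold glueFun
      split_ifs with a b
      · rfl
      · linarith
      · rfl
    rw [this]
    exact e₁.ite_lt e₃ u

/-- `glueFun` as a map into the space of càdlàg functions. -/
def glue (p : unitInterval × unitInterval) (f₀ f₁ : CadlagPath) : CadlagPath :=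
  ⟨glueFun p.1 p.2 f₀.1 f₁.1, isCadlag_glueFun p.1 p.2 f₀.2 f₁.2⟩

/-- The law on `[0, 1]²` with density `2 · 1{u ≤ v}`. -/
def chordLaw : Measure (unitInterval × unitInterval) :=
  volume.withDensity (Set.indicator {p | p.1 ≤ p.2} (fun _ => 2))

/-- The map sending `μ` to the law of `glue (U, V) X⁽⁰⁾ X⁽¹⁾`, where `X⁽⁰⁾` and `X⁽¹⁾` have
law `μ`, `(U, V)` has law `chordLaw`, and the three are independent. -/
def glueLaw (μ : Measure CadlagPath) : Measure CadlagPath :=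
  (chordLaw.prod (μ.prod μ)).map (fun w => glue w.1 w.2.1 w.2.2)

/-- `X` is a càdlàg process on the probability space `(Ω, P)` that solves the fixed-point
equation in distribution and satisfies `E[X(ξ)] = κ B(β + 1, β + 1)`, with `ξ` uniform on
`[0, 1]` and independent of `X`, and `E[‖X‖²] < ∞`, with `‖·‖` the supremum norm. -/
structure IsSolution {Ω : Type*} [MeasurableSpace Ω] (P : Measure Ω) (X : Ω → CadlagPath) :
    Prop where
  measurable : Measurable X
  fixed_point : P.map X = glueLaw (P.map X)
  mean : ∫ w : Ω × unitInterval, (X w.1).1 w.2 ∂(P.prod volume) = κ * betaFn (β + 1) (β + 1)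
  second_moment : ∫⁻ ω, (⨆ s, ‖(X ω).1 s‖ₑ) ^ 2 ∂P < ⊤

theorem β_nonneg : 0 ≤ β := by
  have : (3 : ℝ) ≤ Real.sqrt 17 := Real.le_sqrt_of_sq_le (by norm_num)
  unfold β
  linarith

/-- The path `κ h`, where `h s = (s (1 - s)) ^ β`. -/
def initialPath : CadlagPath :=
  ⟨fun s => κ * ((s : ℝ) * (1 - s)) ^ β, IsCadlag.of_continuous (continuous_const.mul
    ((show Continuous fun s : unitInterval => (s : ℝ) * (1 - s) by fun_prop).rpow_const
      fun _ => Or.inr β_nonneg))⟩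

/-- The approximation `Zₙ⁽ʷ⁾` at the node `w` of the infinite binary tree of finite words over
`{0, 1}`, for a given family `p` of chords indexed by the nodes: `Z₀⁽ʷ⁾ = κ h` and
`Zₙ₊₁⁽ʷ⁾` glues `Zₙ⁽ʷ¹⁾` into `Zₙ⁽ʷ⁰⁾` along the chord `p w`. -/
def approx (p : List Bool → unitInterval × unitInterval) : ℕ → List Bool → CadlagPath
  | 0, _ => initialPath
  | n + 1, w => glue (p w) (approx p n (w ++ [false])) (approx p n (w ++ [true]))

open Classical in
/-- The limit path `Z`: the uniform limit of the approximations at the root (the zero path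
where they do not converge uniformly). -/
def limitPath (p : List Bool → unitInterval × unitInterval) : CadlagPath :=
  if h : ∃ f : CadlagPath, TendstoUniformly (fun n => (approx p n []).1) f.1 atTop then
    h.choose
  else ⟨fun _ => 0, IsCadlag.of_continuous continuous_const⟩

end ChordTree

end

noncomputable section

namespace ChordTree

@[simp]
lemma coe_toUnit {x : ℝ} (h0 : 0 ≤ x) (h1 : x ≤ 1) : (toUnit x : ℝ) = x := by
  rw [toUnit, Set.projIcc_of_mem zero_le_one ⟨h0, h1⟩]

@[simp]
lemma toUnit_coe (s : unitInterval) : toUnit (s : ℝ) = s := Set.projIcc_val zero_le_one s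

lemma continuous_toUnit : Continuous toUnit := continuous_projIcc (h := zero_le_one)

@[fun_prop]
lemma measurable_toUnit : Measurable toUnit := continuous_toUnit.measurable

lemma monotone_toUnit : Monotone toUnit := Set.monotone_projIcc zero_le_one

/-! ### Measurability on the space of càdlàg paths -/

/-- The points `min 1 ((k + 1) / (n + 1))`, a countable family that is dense from the right. -/
def gridPoint (n k : ℕ) : unitInterval := toUnit ((k + 1) / (n + 1))

lemma tendsto_gridPoint (s : unitInterval) :
    Tendsto (fun n : ℕ => gridPoint n ⌊((n : ℝ) + 1) * s⌋₊) atTop (𝓝[≥] s) := by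
  refine tendsto_nhdsWithin_iff.2 ⟨?_, Eventually.of_forall fun n => ?_⟩
  · have h : Tendsto (fun n : ℕ => ((⌊((n : ℝ) + 1) * s⌋₊ : ℝ) + 1) / ((n : ℝ) + 1)) atTop
        (𝓝 (s : ℝ)) := by
      have h1 : Tendsto (fun n : ℕ => (s : ℝ) + 1 / ((n : ℝ) + 1)) atTop (𝓝 ((s : ℝ) + 0)) :=
        tendsto_const_nhds.add tendsto_one_div_add_atTop_nhds_zero_nat
      rw [add_zero] at h1
      refine tendsto_of_tendsto_of_tendsto_of_le_of_le tendsto_const_nhds h1 (fun n => ?_)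
        fun n => ?_
      · have := (Nat.lt_floor_add_one (((n : ℝ) + 1) * s)).le
        change (s : ℝ) ≤ _
        rw [le_div_iff₀ (by positivity)]
        linarith
      · have := Nat.floor_le (a := ((n : ℝ) + 1) * s) (mul_nonneg (by positivity) s.2.1)
        have hn : (0 : ℝ) < n + 1 := by positivity
        change _ ≤ (s : ℝ) + 1 / ((n : ℝ) + 1)
        rw [div_le_iff₀ hn, add_mul (s : ℝ), one_div, inv_mul_cancel₀ hn.ne']
        linarith
    have := (continuous_toUnit.tendsto (s : ℝ)).comp h
    rwa [toUnit_coe] at this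
  · have := (Nat.lt_floor_add_one (((n : ℝ) + 1) * s)).le
    change s ≤ toUnit _
    rw [← toUnit_coe s]
    refine monotone_toUnit ?_
    rw [toUnit_coe, le_div_iff₀ (by positivity)]
    linarith

lemma IsCadlag.tendsto_grid {f : unitInterval → ℝ} (hf : IsCadlag f) (s : unitInterval) :
    Tendsto (fun n : ℕ => f (gridPoint n ⌊((n : ℝ) + 1) * s⌋₊)) atTop (𝓝 (f s)) :=
  (hf.1 s).tendsto.comp (tendsto_gridPoint s)

@[fun_prop]
lemma measurable_eval (s : unitInterval) : Measurable fun f : CadlagPath => f.1 s :=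
  (measurable_pi_apply s).comp measurable_subtype_coe

lemma measurable_eval_uncurry :
    Measurable fun w : CadlagPath × unitInterval => w.1.1 w.2 := by
  refine measurable_of_tendsto_metrizable
    (f := fun n w => w.1.1 (gridPoint n ⌊((n : ℝ) + 1) * w.2⌋₊)) (fun n => ?_) ?_
  · have h : Measurable fun w : CadlagPath × ℕ => w.1.1 (gridPoint n w.2) :=
      measurable_from_prod_countable_left fun k =>
        measurable_eval (gridPoint n k)
    refine h.comp (measurable_fst.prodMk ?_)
    exact Nat.measurable_floor.comp (by fun_prop)
  · exact tendsto_pi_nhds.2 fun w => w.1.2.tendsto_grid w.2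

@[fun_prop]
lemma measurable_eval_path {α : Type*} [MeasurableSpace α] {f : α → CadlagPath}
    {g : α → unitInterval} (hf : Measurable f) (hg : Measurable g) :
    Measurable fun a => (f a).1 (g a) :=
  measurable_eval_uncurry.comp (hf.prodMk hg)

lemma measurable_path_iff {α : Type*} [MeasurableSpace α] {f : α → CadlagPath} :
    Measurable f ↔ ∀ s, Measurable fun a => (f a).1 s :=
  ⟨fun h s => (measurable_eval s).comp h,
    fun h => Measurable.subtype_mk (measurable_pi_iff.2 h)⟩

/-- The supremum norm of a path. -/
def supNorm (f : CadlagPath) : ENNReal := ⨆ s, ‖f.1 s‖ₑ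

lemma enorm_le_supNorm (f : CadlagPath) (s : unitInterval) : ‖f.1 s‖ₑ ≤ supNorm f :=
  le_iSup (fun s => ‖f.1 s‖ₑ) s

lemma supNorm_eq_iSup_grid (f : CadlagPath) :
    supNorm f = ⨆ n, ⨆ k, ‖f.1 (gridPoint n k)‖ₑ := by
  refine le_antisymm (iSup_le fun s => ?_) (iSup₂_le fun n k => enorm_le_supNorm f _)
  refine le_of_tendsto (f.2.tendsto_grid s).enorm (Eventually.of_forall fun n => ?_)
  exact le_iSup₂ (f := fun n k => ‖f.1 (gridPoint n k)‖ₑ) n _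

@[fun_prop]
lemma measurable_supNorm : Measurable supNorm := by
  have : supNorm = fun f => ⨆ n, ⨆ k, ‖f.1 (gridPoint n k)‖ₑ := funext supNorm_eq_iSup_grid
  rw [this]
  exact Measurable.iSup fun n => Measurable.iSup fun k => (measurable_eval _).enorm

/-! ### Gluing -/

lemma measurable_glueFun {α : Type*} [MeasurableSpace α]
    {p : α → unitInterval × unitInterval} {f g : α → CadlagPath} {t : α → unitInterval}
    (hp : Measurable p) (hf : Measurable f) (hg : Measurable g) (ht : Measurable t) :
    Measurable fun a => (glue (p a) (f a) (g a)).1 (t a) := by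
  unfold glue glueFun
  refine Measurable.ite (measurableSet_lt (by fun_prop) (by fun_prop)) (by fun_prop) ?_
  exact Measurable.ite (measurableSet_lt (by fun_prop) (by fun_prop)) (by fun_prop) (by fun_prop)

@[fun_prop]
lemma measurable_glue {α : Type*} [MeasurableSpace α]
    {p : α → unitInterval × unitInterval} {f g : α → CadlagPath}
    (hp : Measurable p) (hf : Measurable f) (hg : Measurable g) :
    Measurable fun a => glue (p a) (f a) (g a) :=
  measurable_path_iff.2 fun _ => measurable_glueFun hp hf hg measurable_const

/-- The difference of two paths. -/
def diff (f g : CadlagPath) : CadlagPath :=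
  ⟨fun s => f.1 s - g.1 s, fun s => (f.2.1 s).sub (g.2.1 s),
    fun s => (f.2.2 s).elim fun _ h => (g.2.2 s).elim fun _ h' => ⟨_, h.sub h'⟩⟩

@[fun_prop]
lemma measurable_diff {α : Type*} [MeasurableSpace α] {f g : α → CadlagPath}
    (hf : Measurable f) (hg : Measurable g) : Measurable fun a => diff (f a) (g a) :=
  measurable_path_iff.2 fun s => ((measurable_eval s).comp hf).sub ((measurable_eval s).comp hg)

lemma glue_diff (p : unitInterval × unitInterval) (f₀ f₁ g₀ g₁ : CadlagPath) :
    glue p (diff f₀ g₀) (diff f₁ g₁) = diff (glue p f₀ f₁) (glue p g₀ g₁) := by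
  refine Subtype.ext (funext fun s => ?_)
  simp only [glue, diff, glueFun]
  split_ifs <;> ring

lemma supNorm_diff_le (f g : CadlagPath) : supNorm (diff f g) ≤ supNorm f + supNorm g :=
  iSup_le fun s => (enorm_sub_le).trans (add_le_add (enorm_le_supNorm f s) (enorm_le_supNorm g s))

/-! ### Integration over chords -/

lemma lintegral_unitInterval (F : ℝ → ENNReal) :
    ∫⁻ s : unitInterval, F s = ∫⁻ x in Set.Ico (0 : ℝ) 1, F x := by
  rw [setLIntegral_congr Ico_ae_eq_Icc]
  exact unitInterval.measurePreserving_coe.lintegral_comp_emb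
    unitInterval.measurableEmbedding_coe F

lemma lintegral_Ico_affine (F : ℝ → ENNReal) (a : ℝ) {b : ℝ} (hb : 0 < b) (c d : ℝ) :
    ∫⁻ s in Set.Ico (a + b * c) (a + b * d), F s =
      ENNReal.ofReal b * ∫⁻ t in Set.Ico c d, F (a + b * t) := by
  have himg : (fun t : ℝ => b * t + a) '' Set.Ico c d = Set.Ico (a + b * c) (a + b * d) := by
    rw [Set.image_affine_Ico hb, add_comm a, add_comm a]
  have hderiv : ∀ x ∈ Set.Ico c d,
      HasDerivWithinAt (fun t : ℝ => b * t + a) b (Set.Ico c d) x := fun x _ => by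
    simpa using (((hasDerivAt_id x).const_mul b).add_const a).hasDerivWithinAt
  have hinj : Set.InjOn (fun t : ℝ => b * t + a) (Set.Ico c d) := fun x _ y _ h => by
    have : b * x = b * y := add_right_cancel h
    exact mul_left_cancel₀ hb.ne' this
  rw [← himg, lintegral_image_eq_lintegral_abs_deriv_mul measurableSet_Ico hderiv hinj,
    lintegral_const_mul' _ _ ENNReal.ofReal_ne_top, abs_of_pos hb]
  simp_rw [add_comm a]

lemma lintegral_Ico_sub_div (F : ℝ → ENNReal) (a : ℝ) {b : ℝ} (hb : 0 ≤ b) :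
    ∫⁻ s in Set.Ico a (a + b), F ((s - a) / b) =
      ENNReal.ofReal b * ∫⁻ t in Set.Ico (0 : ℝ) 1, F t := by
  rcases hb.eq_or_lt with rfl | hb
  · simp
  · have := lintegral_Ico_affine (fun s => F ((s - a) / b)) a hb 0 1
    rw [mul_zero, add_zero, mul_one] at this
    rw [this]
    congr 1
    refine lintegral_congr fun t => ?_
    rw [add_sub_cancel_left, mul_div_cancel_left₀ _ hb.ne']

lemma lintegral_Ico_sub (F : ℝ → ENNReal) (a c d : ℝ) :
    ∫⁻ s in Set.Ico (a + c) (a + d), F (s - a) = ∫⁻ t in Set.Ico c d, F t := by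
  have := lintegral_Ico_affine (fun s => F (s - a)) a one_pos c d
  simpa using this

lemma lintegral_Ico_split (F : ℝ → ENNReal) {a b c : ℝ} (hab : a ≤ b) (hbc : b ≤ c) :
    ∫⁻ s in Set.Ico a c, F s = (∫⁻ s in Set.Ico a b, F s) + ∫⁻ s in Set.Ico b c, F s := by
  rw [← Set.Ico_union_Ico_eq_Ico hab hbc, lintegral_union measurableSet_Ico]
  exact Set.disjoint_left.2 fun x h h' => absurd h.2 (not_lt.2 h'.1)

/-- The length `v - u` of a chord. -/
def gap (p : unitInterval × unitInterval) : unitInterval := toUnit (p.2 - p.1)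

/-- The position `u / (1 - (v - u))` at which a chord cuts the path `f₀`. -/
def cut (p : unitInterval × unitInterval) : unitInterval :=
  toUnit (p.1 / (1 - ((p.2 : ℝ) - p.1)))

@[fun_prop]
lemma measurable_gap : Measurable gap := by unfold gap; fun_prop

@[fun_prop]
lemma measurable_cut : Measurable cut := by unfold cut; fun_prop

lemma coe_gap {p : unitInterval × unitInterval} (hp : p.1 ≤ p.2) :
    (gap p : ℝ) = p.2 - p.1 := by
  have h : (p.1 : ℝ) ≤ p.2 := hp
  exact coe_toUnit (by linarith) (by linarith [p.2.2.2, p.1.2.1])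

lemma lintegral_glueFun {u v : unitInterval} (h : u ≤ v) (f₀ f₁ : unitInterval → ℝ)
    (Φ : ℝ → ENNReal) :
    ∫⁻ s, Φ (glueFun u v f₀ f₁ s) =
      ENNReal.ofReal (1 - gap (u, v)) * (∫⁻ t, Φ ((1 - (gap (u, v) : ℝ)) ^ β * f₀ t)) +
      ENNReal.ofReal (gap (u, v)) *
        ∫⁻ t, Φ ((1 - (gap (u, v) : ℝ)) ^ β * f₀ (cut (u, v)) + (gap (u, v) : ℝ) ^ β * f₁ t) := by
  have hc : cut (u, v) = toUnit (u / (1 - (gap (u, v) : ℝ))) := by rw [coe_gap h]; rfl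
  have hx0 : 0 ≤ (gap (u, v) : ℝ) := (gap (u, v)).2.1
  have hx1 : (gap (u, v) : ℝ) ≤ 1 := (gap (u, v)).2.2
  have hv : (v : ℝ) = u + gap (u, v) := by rw [coe_gap h]; ring
  rw [hc]
  generalize (gap (u, v) : ℝ) = x at *
  have hu0 := u.2.1
  have hv1 := v.2.2
  set A : ℝ → ENNReal := fun r => Φ ((1 - x) ^ β * f₀ (toUnit r)) with hA
  set B : ℝ → ENNReal := fun r =>
    Φ ((1 - x) ^ β * f₀ (toUnit (u / (1 - x))) + x ^ β * f₁ (toUnit r)) with hB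
  have hL : ∫⁻ s, Φ (glueFun u v f₀ f₁ s) = ∫⁻ s : unitInterval, (fun r : ℝ =>
      if r < u then A (r / (1 - x)) else if r < v then B ((r - u) / x) else
        A ((r - x) / (1 - x))) s := by
    refine lintegral_congr fun s => ?_
    have hvu : (v : ℝ) - u = x := by rw [hv]; ring
    simp only [glueFun, hA, hB, hvu]
    split_ifs <;> rfl
  have hA' : ∫⁻ t, Φ ((1 - x) ^ β * f₀ t) = ∫⁻ t in Set.Ico (0 : ℝ) 1, A t := by
    rw [← lintegral_unitInterval]; simp [hA]
  have hB' : ∫⁻ t, Φ ((1 - x) ^ β * f₀ (toUnit (u / (1 - x))) + x ^ β * f₁ t) =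
      ∫⁻ t in Set.Ico (0 : ℝ) 1, B t := by
    rw [← lintegral_unitInterval]; simp [hB]
  rw [hL, hA', hB', lintegral_unitInterval fun r : ℝ =>
      if r < u then A (r / (1 - x)) else if r < v then B ((r - u) / x) else
        A ((r - x) / (1 - x)), lintegral_Ico_split _ hu0 (by linarith : (u : ℝ) ≤ 1),
    lintegral_Ico_split _ (by linarith : (u : ℝ) ≤ v) hv1]
  have e1 : ∫⁻ r in Set.Ico (0 : ℝ) u, (if r < u then A (r / (1 - x)) else
      if r < v then B ((r - u) / x) else A ((r - x) / (1 - x))) =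
      ∫⁻ r in Set.Ico (0 : ℝ) u, A (r / (1 - x)) :=
    setLIntegral_congr_fun measurableSet_Ico fun r hr => if_pos hr.2
  have e2 : ∫⁻ r in Set.Ico (u : ℝ) v, (if r < u then A (r / (1 - x)) else
      if r < v then B ((r - u) / x) else A ((r - x) / (1 - x))) =
      ∫⁻ r in Set.Ico (u : ℝ) v, B ((r - u) / x) :=
    setLIntegral_congr_fun measurableSet_Ico fun r hr =>
      (if_neg (not_lt.2 hr.1)).trans (if_pos hr.2)
  have e3 : ∫⁻ r in Set.Ico (v : ℝ) 1, (if r < u then A (r / (1 - x)) else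
      if r < v then B ((r - u) / x) else A ((r - x) / (1 - x))) =
      ∫⁻ r in Set.Ico (v : ℝ) 1, A ((r - x) / (1 - x)) :=
    setLIntegral_congr_fun measurableSet_Ico fun r hr =>
      (if_neg (not_lt.2 (by linarith [hr.1]))).trans (if_neg (not_lt.2 hr.1))
  have e4 : ∫⁻ r in Set.Ico (v : ℝ) 1, A ((r - x) / (1 - x)) =
      ∫⁻ r in Set.Ico (u : ℝ) (1 - x), A (r / (1 - x)) := by
    have := lintegral_Ico_sub (fun r => A (r / (1 - x))) x u (1 - x)
    rwa [add_sub_cancel, add_comm x, ← hv] at this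
  have e5 := lintegral_Ico_sub_div A 0 (by linarith : 0 ≤ 1 - x)
  have e6 := lintegral_Ico_sub_div B u hx0
  simp only [sub_zero, zero_add] at e5
  rw [← hv] at e6
  rw [e1, e2, e3, e4, e6, ← e5, lintegral_Ico_split _ hu0 (by linarith : (u : ℝ) ≤ 1 - x)]
  abel

/-- The law of the length of a random chord, of density `2 (1 - x)`. -/
def gapLaw : Measure unitInterval :=
  volume.withDensity fun x => ENNReal.ofReal (2 * (1 - x))

lemma lintegral_gapLaw {F : unitInterval → ENNReal} (hF : Measurable F) :
    ∫⁻ x, F x ∂gapLaw = ∫⁻ x : unitInterval, ENNReal.ofReal (2 * (1 - x)) * F x := by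
  rw [gapLaw, lintegral_withDensity_eq_lintegral_mul _ (by fun_prop) hF]
  rfl

lemma measurableSet_chord : MeasurableSet {p : unitInterval × unitInterval | p.1 ≤ p.2} :=
  measurableSet_le measurable_fst measurable_snd

lemma ae_chordLaw_le : ∀ᵐ p ∂chordLaw, p.1 ≤ p.2 := by
  rw [chordLaw, ae_withDensity_iff (measurable_const.indicator measurableSet_chord)]
  refine Eventually.of_forall fun p hp => ?_
  by_contra h
  exact hp (Set.indicator_of_notMem (s := {p : unitInterval × unitInterval | p.1 ≤ p.2}) h _)

lemma lintegral_chordLaw_gap_cut {F : unitInterval × unitInterval → ENNReal}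
    (hF : Measurable F) :
    ∫⁻ p, F (gap p, cut p) ∂chordLaw = ∫⁻ x, (∫⁻ t, F (x, t)) ∂gapLaw := by
  have hm : Measurable fun p => F (gap p, cut p) := by fun_prop
  rw [chordLaw, lintegral_withDensity_eq_lintegral_mul _
    (measurable_const.indicator measurableSet_chord) hm, Measure.volume_eq_prod,
    lintegral_prod _ ((measurable_const.indicator measurableSet_chord).mul hm).aemeasurable,
    lintegral_gapLaw (by fun_prop)]
  set K : ℝ → ℝ → ENNReal := fun u x => Set.indicator {q : ℝ × ℝ | q.1 < 1 - q.2}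
    (fun q => 2 * F (toUnit q.2, toUnit (q.1 / (1 - q.2)))) (u, x) with hK
  have hKm : Measurable (Function.uncurry K) := by
    refine Measurable.indicator (by fun_prop) (measurableSet_lt (by fun_prop) (by fun_prop))
  have inner : ∀ u : unitInterval, ∫⁻ v : unitInterval,
      ((Set.indicator {p : unitInterval × unitInterval | p.1 ≤ p.2} fun _ => (2 : ENNReal)) *
        fun p => F (gap p, cut p)) (u, v) = ∫⁻ x in Set.Ico (0 : ℝ) 1, K u x := by
    intro u
    have hu0 := u.2.1
    have hu1 := u.2.2
    have e : ∀ v : unitInterval,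
        ((Set.indicator {p : unitInterval × unitInterval | p.1 ≤ p.2} fun _ => (2 : ENNReal)) *
        fun p => F (gap p, cut p)) (u, v) = (fun r : ℝ => Set.indicator {r : ℝ | u ≤ r}
          (fun r => 2 * F (toUnit (r - u), toUnit (u / (1 - (r - u))))) r) v := by
      intro v
      by_cases h : (u : ℝ) ≤ v
      · have h' : u ≤ v := h
        simp [Set.indicator, h', gap, cut]
      · have h' : ¬ u ≤ v := h
        simp [Set.indicator, h']
    rw [lintegral_congr e, lintegral_unitInterval fun r : ℝ => Set.indicator {r : ℝ | u ≤ r}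
          (fun r => 2 * F (toUnit (r - u), toUnit (u / (1 - (r - u))))) r,
      lintegral_Ico_split _ hu0 hu1,
      lintegral_Ico_split _ (by linarith : 0 ≤ 1 - (u : ℝ)) (by linarith : 1 - (u : ℝ) ≤ 1)]
    have e1 : ∫⁻ r in Set.Ico (0 : ℝ) u, Set.indicator {r : ℝ | u ≤ r}
        (fun r => 2 * F (toUnit (r - u), toUnit (u / (1 - (r - u))))) r = 0 := by
      refine (setLIntegral_congr_fun measurableSet_Ico (g := fun _ : ℝ => (0 : ENNReal)) fun r hr =>
        Set.indicator_of_notMem (not_le.2 hr.2) _).trans (by simp)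
    have e2 : ∫⁻ x in Set.Ico (1 - (u : ℝ)) 1, K u x = 0 := by
      refine (setLIntegral_congr_fun measurableSet_Ico (g := fun _ : ℝ => (0 : ENNReal)) fun r hr =>
        Set.indicator_of_notMem ?_ _).trans (by simp)
      have := hr.1
      simp only [Set.mem_ofPred_eq, not_lt]
      linarith
    have e3 : ∫⁻ r in Set.Ico (u : ℝ) 1, Set.indicator {r : ℝ | u ≤ r}
        (fun r => 2 * F (toUnit (r - u), toUnit (u / (1 - (r - u))))) r =
        ∫⁻ r in Set.Ico (u : ℝ) 1, 2 * F (toUnit (r - u), toUnit (u / (1 - (r - u)))) :=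
      setLIntegral_congr_fun measurableSet_Ico fun r hr =>
        Set.indicator_of_mem (s := {r : ℝ | u ≤ r}) hr.1 _
    have e4 : ∫⁻ x in Set.Ico (0 : ℝ) (1 - u), K u x =
        ∫⁻ x in Set.Ico (0 : ℝ) (1 - u), 2 * F (toUnit x, toUnit (u / (1 - x))) := by
      refine setLIntegral_congr_fun measurableSet_Ico fun r hr => Set.indicator_of_mem ?_ _
      have := hr.2
      simp only [Set.mem_ofPred_eq]
      linarith
    have e5 := lintegral_Ico_sub (fun x => 2 * F (toUnit x, toUnit (u / (1 - x)))) u 0 (1 - u)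
    rw [add_zero, add_sub_cancel] at e5
    rw [e1, e2, e3, e4, e5, zero_add, add_zero]
  rw [lintegral_congr inner, lintegral_unitInterval fun u => ∫⁻ x in Set.Ico (0 : ℝ) 1, K u x,
    lintegral_lintegral_swap hKm.aemeasurable]
  have outer : ∀ x : unitInterval,
      ENNReal.ofReal (2 * (1 - x)) * ∫⁻ t, F (x, t) = (fun x : ℝ =>
        ENNReal.ofReal (2 * (1 - x)) * ∫⁻ t, F (toUnit x, t)) x := fun x => by simp
  rw [lintegral_congr outer, lintegral_unitInterval fun x : ℝ =>
        ENNReal.ofReal (2 * (1 - x)) * ∫⁻ t, F (toUnit x, t)]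
  refine setLIntegral_congr_fun measurableSet_Ico fun x hx => ?_
  have hx1 : 0 < 1 - x := by linarith [hx.2]
  have e1 : ∫⁻ u in Set.Ico (1 - x) 1, K u x = 0 :=
    (setLIntegral_congr_fun measurableSet_Ico (g := fun _ : ℝ => (0 : ENNReal)) fun r hr =>
        Set.indicator_of_notMem (s := {q : ℝ × ℝ | q.1 < 1 - q.2}) (not_lt.2 hr.1) _).trans
      (by simp)
  have e2 : ∫⁻ u in Set.Ico 0 (1 - x), K u x =
      ∫⁻ u in Set.Ico 0 (1 - x), 2 * F (toUnit x, toUnit (u / (1 - x))) :=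
    setLIntegral_congr_fun measurableSet_Ico fun r hr =>
      Set.indicator_of_mem (s := {q : ℝ × ℝ | q.1 < 1 - q.2}) hr.2 _
  have e3 := lintegral_Ico_sub_div (fun t => 2 * F (toUnit x, toUnit t)) 0 hx1.le
  simp only [sub_zero, zero_add] at e3
  have e4 : ∫⁻ t, F (toUnit x, t) = ∫⁻ t in Set.Ico (0 : ℝ) 1, F (toUnit x, toUnit t) := by
    rw [← lintegral_unitInterval fun t => F (toUnit x, toUnit t)]
    simp

  rw [lintegral_Ico_split _ hx1.le (by linarith [hx.1] : 1 - x ≤ 1), e1, e2, e3, add_zero, e4,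
    lintegral_const_mul' _ _ (by simp), ENNReal.ofReal_mul (by norm_num), ← mul_assoc,
    mul_comm (ENNReal.ofReal (1 - x))]
  simp

lemma lintegral_chordLaw_gap {F : unitInterval → ENNReal} (hF : Measurable F) :
    ∫⁻ p, F (gap p) ∂chordLaw = ∫⁻ x, F x ∂gapLaw := by
  have := lintegral_chordLaw_gap_cut (F := fun w => F w.1) (by fun_prop)
  simpa using this

/-! ### Moments of the length of a random chord -/

lemma β_sq : β ^ 2 + 3 * β = 2 := by
  have := Real.sq_sqrt (show (0 : ℝ) ≤ 17 by norm_num)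
  unfold β
  nlinarith

lemma le_β : 0.56 ≤ β := by
  have : (4.12 : ℝ) ≤ Real.sqrt 17 := Real.le_sqrt_of_sq_le (by norm_num)
  unfold β
  linarith

lemma β_pos : 0 < β := lt_of_lt_of_le (by norm_num) le_β

lemma integral_unitInterval (g : ℝ → ℝ) :
    ∫ x : unitInterval, g x = ∫ x in (0 : ℝ)..1, g x := by
  rw [intervalIntegral.integral_of_le zero_le_one, ← integral_Icc_eq_integral_Ioc]
  exact unitInterval.measurePreserving_coe.integral_comp
    unitInterval.measurableEmbedding_coe g

lemma integral_gapLaw (g : ℝ → ℝ) :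
    ∫ x, g x ∂gapLaw = ∫ x in (0 : ℝ)..1, 2 * (1 - x) * g x := by
  rw [gapLaw, integral_withDensity_eq_integral_toReal_smul (by fun_prop)
    (Eventually.of_forall fun _ => ENNReal.ofReal_lt_top),
    ← integral_unitInterval fun x => 2 * (1 - x) * g x]
  refine integral_congr_ae (Eventually.of_forall fun x => ?_)
  have := x.2.2
  simp only [ENNReal.toReal_ofReal (show 0 ≤ 2 * (1 - (x : ℝ)) by linarith), smul_eq_mul]

lemma integral_gapLaw_rpow {s : ℝ} (hs : 0 ≤ s) :
    ∫ x, (x : ℝ) ^ s ∂gapLaw = 2 / (s + 1) - 2 / (s + 2) := by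
  rw [integral_gapLaw fun x => x ^ s]
  have : ∫ x in (0 : ℝ)..1, 2 * (1 - x) * x ^ s =
      ∫ x in (0 : ℝ)..1, (2 * x ^ s - 2 * x ^ (s + 1)) := by
    refine intervalIntegral.integral_congr fun x hx => ?_
    rw [Set.uIcc_of_le zero_le_one] at hx
    simp only [Real.rpow_add_one' hx.1 (by linarith : s + 1 ≠ 0)]
    ring
  rw [this, intervalIntegral.integral_sub, intervalIntegral.integral_const_mul,
    intervalIntegral.integral_const_mul, integral_rpow (Or.inl (by linarith)),
    integral_rpow (Or.inl (by linarith)), Real.one_rpow, Real.one_rpow,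
    Real.zero_rpow (by linarith), Real.zero_rpow (by linarith)]
  · ring
  · exact (intervalIntegral.intervalIntegrable_rpow' (by linarith)).const_mul _
  · exact (intervalIntegral.intervalIntegrable_rpow' (by linarith)).const_mul _

lemma integral_gapLaw_one_sub_rpow {s : ℝ} (hs : 0 ≤ s) :
    ∫ x, (1 - (x : ℝ)) ^ s ∂gapLaw = 2 / (s + 2) := by
  rw [integral_gapLaw fun x => (1 - x) ^ s]
  have : ∫ x in (0 : ℝ)..1, 2 * (1 - x) * (1 - x) ^ s = ∫ x in (0 : ℝ)..1, 2 * x ^ (s + 1) := by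
    have := intervalIntegral.integral_comp_sub_left (a := 0) (b := 1)
      (fun x : ℝ => 2 * x ^ (s + 1)) 1
    rw [sub_zero, sub_self] at this
    rw [← this]
    refine intervalIntegral.integral_congr fun x hx => ?_
    rw [Set.uIcc_of_le zero_le_one] at hx
    simp only [Real.rpow_add_one' (sub_nonneg.2 hx.2) (by linarith : s + 1 ≠ 0)]
    ring
  rw [this, intervalIntegral.integral_const_mul, integral_rpow (Or.inl (by linarith)),
    Real.one_rpow, Real.zero_rpow (by linarith)]
  ring

instance : IsProbabilityMeasure gapLaw := by
  have hf : IsFiniteMeasure gapLaw := by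
    refine ⟨?_⟩
    rw [← setLIntegral_one, Measure.restrict_univ, lintegral_gapLaw measurable_const]
    refine (lintegral_mono (g := fun _ => 2) fun x => ?_).trans_lt (by simp)
    rw [mul_one, ← ENNReal.ofReal_ofNat]
    exact ENNReal.ofReal_le_ofReal (by linarith [x.2.1])
  refine ⟨?_⟩
  have := integral_gapLaw_rpow le_rfl
  simp only [Real.rpow_zero, integral_const, smul_eq_mul, mul_one] at this
  rw [← ENNReal.ofReal_toReal (measure_ne_top gapLaw Set.univ)]
  change ENNReal.ofReal (gapLaw.real Set.univ) = 1
  rw [this]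
  norm_num

instance : IsProbabilityMeasure chordLaw := by
  refine ⟨?_⟩
  have := lintegral_chordLaw_gap (F := fun _ => 1) measurable_const
  simpa using this

lemma integrable_gapLaw {g : unitInterval → ℝ} (hg : Continuous g) : Integrable g gapLaw :=
  hg.integrable_of_hasCompactSupport (HasCompactSupport.of_compactSpace g)

lemma lintegral_gapLaw_ofReal {g : unitInterval → ℝ} (hg : Continuous g) (h0 : ∀ x, 0 ≤ g x) :
    ∫⁻ x, ENNReal.ofReal (g x) ∂gapLaw = ENNReal.ofReal (∫ x, g x ∂gapLaw) :=
  (ofReal_integral_eq_lintegral_ofReal (integrable_gapLaw hg) (Eventually.of_forall h0)).symm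

@[fun_prop]
lemma continuous_gap_rpow : Continuous fun x : unitInterval => (x : ℝ) ^ β :=
  (show Continuous fun x : unitInterval => (x : ℝ) by fun_prop).rpow_const
    fun _ => Or.inr β_nonneg

@[fun_prop]
lemma continuous_one_sub_gap_rpow : Continuous fun x : unitInterval => (1 - (x : ℝ)) ^ β :=
  (show Continuous fun x : unitInterval => 1 - (x : ℝ) by fun_prop).rpow_const
    fun _ => Or.inr β_nonneg

lemma rpow_β_nonneg (x : unitInterval) : 0 ≤ (x : ℝ) ^ β := Real.rpow_nonneg x.2.1 _

lemma one_sub_rpow_β_nonneg (x : unitInterval) : 0 ≤ (1 - (x : ℝ)) ^ β :=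
  Real.rpow_nonneg (sub_nonneg.2 x.2.2) _

lemma rpow_β_le_one (x : unitInterval) : (x : ℝ) ^ β ≤ 1 :=
  Real.rpow_le_one x.2.1 x.2.2 β_nonneg

lemma one_sub_rpow_β_le_one (x : unitInterval) : (1 - (x : ℝ)) ^ β ≤ 1 :=
  Real.rpow_le_one (sub_nonneg.2 x.2.2) (by linarith [x.2.1]) β_nonneg

lemma sq_rpow_β {r : ℝ} (hr : 0 ≤ r) : (r ^ β) ^ 2 = r ^ (2 * β) := by
  rw [mul_comm, Real.rpow_mul hr]; norm_num

lemma integral_one_sub_sq : ∫ x, ((1 - (x : ℝ)) ^ β) ^ 2 ∂gapLaw = 1 / (β + 1) := by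
  have := β_pos
  have h := integral_gapLaw_one_sub_rpow (s := 2 * β) (by positivity)
  simp_rw [sq_rpow_β (sub_nonneg.2 (unitInterval.le_one _)), h]
  field_simp

lemma integral_sq : ∫ x, ((x : ℝ) ^ β) ^ 2 ∂gapLaw = 2 / (2 * β + 1) - 2 / (2 * β + 2) := by
  have := β_pos
  have h := integral_gapLaw_rpow (s := 2 * β) (by positivity)
  simp_rw [sq_rpow_β (unitInterval.nonneg _), h]

lemma integral_mul_sq :
    ∫ x, (x : ℝ) * ((x : ℝ) ^ β) ^ 2 ∂gapLaw = 2 / (2 * β + 2) - 2 / (2 * β + 3) := by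
  have := β_pos
  have h := integral_gapLaw_rpow (s := 2 * β + 1) (by positivity)
  simp_rw [sq_rpow_β (unitInterval.nonneg _), mul_comm (_ : ℝ) (_ ^ (_ : ℝ)),
    ← Real.rpow_add_one' (unitInterval.nonneg _) (show 2 * β + 1 ≠ 0 by positivity), h]
  ring

/-- The identity `E[(1 - Δ) ^ β + Δ ^ (β + 1)] = 1` that defines the exponent `β`. -/
lemma integral_mean_factor :
    ∫ x, ((1 - (x : ℝ)) ^ β + (x : ℝ) * (x : ℝ) ^ β) ∂gapLaw = 1 := by
  have := β_pos
  rw [integral_add (integrable_gapLaw (by fun_prop)) (integrable_gapLaw (by fun_prop)),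
    integral_gapLaw_one_sub_rpow this.le]
  simp_rw [mul_comm (_ : ℝ) (_ ^ (_ : ℝ)),
    ← Real.rpow_add_one' (unitInterval.nonneg _) (show β + 1 ≠ 0 by positivity)]
  rw [integral_gapLaw_rpow (by positivity)]
  field_simp
  nlinarith [β_sq]

/-! ### The value of a random path at an independent uniform point -/

/-- The law of `X(ξ)`, where `X` has law `δ` and `ξ` is uniform on `[0, 1]` and independent. -/
def evalLaw (δ : Measure CadlagPath) : Measure ℝ :=
  (δ.prod volume).map fun w => w.1.1 w.2

instance (δ : Measure CadlagPath) [IsProbabilityMeasure δ] : IsProbabilityMeasure (evalLaw δ) :=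
  Measure.isProbabilityMeasure_map measurable_eval_uncurry.aemeasurable

lemma measurable_glue_prod :
    Measurable fun w : (unitInterval × unitInterval) × CadlagPath × CadlagPath =>
      glue w.1 w.2.1 w.2.2 :=
  measurable_glue measurable_fst (measurable_fst.comp measurable_snd)
    (measurable_snd.comp measurable_snd)

instance (δ : Measure CadlagPath) [IsProbabilityMeasure δ] : IsProbabilityMeasure (glueLaw δ) :=
  Measure.isProbabilityMeasure_map measurable_glue_prod.aemeasurable

lemma lintegral_evalLaw (δ : Measure CadlagPath) {Φ : ℝ → ENNReal} (hΦ : Measurable Φ) :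
    ∫⁻ y, Φ y ∂evalLaw δ = ∫⁻ f, (∫⁻ t, Φ (f.1 t)) ∂δ := by
  have hm : Measurable fun w : CadlagPath × unitInterval => Φ (w.1.1 w.2) :=
    hΦ.comp measurable_eval_uncurry
  rw [evalLaw, lintegral_map hΦ measurable_eval_uncurry, lintegral_prod _ hm.aemeasurable]

lemma lintegral_glueLaw (δ : Measure CadlagPath) [SFinite δ] {F : CadlagPath → ENNReal}
    (hF : Measurable F) :
    ∫⁻ f, F f ∂glueLaw δ =
      ∫⁻ p, (∫⁻ f₀, (∫⁻ f₁, F (glue p f₀ f₁) ∂δ) ∂δ) ∂chordLaw := by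
  have hm : Measurable fun w : (unitInterval × unitInterval) × CadlagPath × CadlagPath =>
      F (glue w.1 w.2.1 w.2.2) := hF.comp measurable_glue_prod
  rw [glueLaw, lintegral_map hF measurable_glue_prod, lintegral_prod _ hm.aemeasurable]
  refine lintegral_congr fun p => ?_
  rw [lintegral_prod]
  exact (hF.comp (measurable_glue measurable_const measurable_fst measurable_snd)).aemeasurable

lemma lintegral_evalLaw_glueLaw (δ : Measure CadlagPath) [IsProbabilityMeasure δ]
    {Φ : ℝ → ENNReal} (hΦ : Measurable Φ) :
    ∫⁻ y, Φ y ∂evalLaw (glueLaw δ) = ∫⁻ x,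
      (ENNReal.ofReal (1 - x) * (∫⁻ y, Φ ((1 - (x : ℝ)) ^ β * y) ∂evalLaw δ) +
      ENNReal.ofReal x * ∫⁻ y, (∫⁻ z, Φ ((1 - (x : ℝ)) ^ β * y + (x : ℝ) ^ β * z) ∂evalLaw δ)
        ∂evalLaw δ) ∂gapLaw := by
  set η := evalLaw δ with hη
  have hm : Measurable fun f : CadlagPath => ∫⁻ t, Φ (f.1 t) :=
    (hΦ.comp measurable_eval_uncurry).lintegral_prod_right'
  rw [lintegral_evalLaw _ hΦ, lintegral_glueLaw _ hm]
  set F : unitInterval × unitInterval → ENNReal := fun w =>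
    ENNReal.ofReal (1 - w.1) * (∫⁻ y, Φ ((1 - (w.1 : ℝ)) ^ β * y) ∂η) +
      ENNReal.ofReal w.1 * ∫⁻ f₀ : CadlagPath, (∫⁻ z, Φ ((1 - (w.1 : ℝ)) ^ β * f₀.1 w.2 +
        (w.1 : ℝ) ^ β * z) ∂η) ∂δ with hF
  have hm1 : Measurable fun w : unitInterval × unitInterval =>
      ∫⁻ y, Φ ((1 - (w.1 : ℝ)) ^ β * y) ∂η :=
    Measurable.lintegral_prod_right' (f := fun q : (unitInterval × unitInterval) × ℝ =>
      Φ ((1 - (q.1.1 : ℝ)) ^ β * q.2)) (by fun_prop)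
  have hm2 : Measurable fun w : ℝ × unitInterval =>
      ∫⁻ z, Φ ((1 - (w.2 : ℝ)) ^ β * w.1 + (w.2 : ℝ) ^ β * z) ∂η :=
    Measurable.lintegral_prod_right' (f := fun q : (ℝ × unitInterval) × ℝ =>
      Φ ((1 - (q.1.2 : ℝ)) ^ β * q.1.1 + (q.1.2 : ℝ) ^ β * q.2)) (by fun_prop)
  have hm3 : Measurable fun w : unitInterval × unitInterval =>
      ∫⁻ f₀ : CadlagPath, (∫⁻ z, Φ ((1 - (w.1 : ℝ)) ^ β * f₀.1 w.2 +
        (w.1 : ℝ) ^ β * z) ∂η) ∂δ :=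
    Measurable.lintegral_prod_right' (f := fun q : (unitInterval × unitInterval) × CadlagPath =>
      ∫⁻ z, Φ ((1 - (q.1.1 : ℝ)) ^ β * q.2.1 q.1.2 + (q.1.1 : ℝ) ^ β * z) ∂η)
      (hm2.comp ((measurable_eval_path measurable_snd (by fun_prop)).prodMk (by fun_prop)))
  have hFm : Measurable F := by
    refine Measurable.add (Measurable.mul (by fun_prop) hm1) (Measurable.mul (by fun_prop) hm3)
  have step : ∀ᵐ p ∂chordLaw, ∫⁻ f₀, (∫⁻ f₁, (∫⁻ t, Φ ((glue p f₀ f₁).1 t)) ∂δ) ∂δ =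
      F (gap p, cut p) := by
    filter_upwards [ae_chordLaw_le] with p hp
    set a := (1 - (gap p : ℝ)) ^ β with ha
    set b := (gap p : ℝ) ^ β with hb
    have e1 : ∀ f₀ : CadlagPath, ∫⁻ f₁, (∫⁻ t, Φ ((glue p f₀ f₁).1 t)) ∂δ =
        ENNReal.ofReal (1 - gap p) * (∫⁻ t, Φ (a * f₀.1 t)) +
        ENNReal.ofReal (gap p) * ∫⁻ z, Φ (a * f₀.1 (cut p) + b * z) ∂η := by
      intro f₀
      have : ∀ f₁ : CadlagPath, ∫⁻ t, Φ ((glue p f₀ f₁).1 t) =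
          ENNReal.ofReal (1 - gap p) * (∫⁻ t, Φ (a * f₀.1 t)) +
          ENNReal.ofReal (gap p) * ∫⁻ t, Φ (a * f₀.1 (cut p) + b * f₁.1 t) := fun f₁ =>
        lintegral_glueFun (u := p.1) (v := p.2) hp f₀.1 f₁.1 Φ
      rw [lintegral_congr this, lintegral_add_left measurable_const, lintegral_const,
        measure_univ, mul_one, lintegral_const_mul' _ _ ENNReal.ofReal_ne_top, hη,
        lintegral_evalLaw δ (Φ := fun z => Φ (a * f₀.1 (cut p) + b * z)) (by fun_prop)]
    have hm4 : Measurable fun f₀ : CadlagPath => ∫⁻ t, Φ (a * f₀.1 t) :=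
      Measurable.lintegral_prod_right' (f := fun q : CadlagPath × unitInterval =>
        Φ (a * q.1.1 q.2)) (hΦ.comp (measurable_eval_uncurry.const_mul a))
    rw [lintegral_congr e1, lintegral_add_left (hm4.const_mul _),
      lintegral_const_mul' _ _ ENNReal.ofReal_ne_top,
      lintegral_const_mul' _ _ ENNReal.ofReal_ne_top, hF,
      ← lintegral_evalLaw δ (Φ := fun z => Φ (a * z)) (by fun_prop)]
  rw [lintegral_congr_ae step, lintegral_chordLaw_gap_cut hFm]
  refine lintegral_congr fun x => ?_
  have hm5 : Measurable fun t => ∫⁻ f₀ : CadlagPath, (∫⁻ z, Φ ((1 - (x : ℝ)) ^ β * f₀.1 t +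
        (x : ℝ) ^ β * z) ∂η) ∂δ := hm3.comp (measurable_const.prodMk measurable_id)
  have hm6 : Measurable fun y => ∫⁻ z, Φ ((1 - (x : ℝ)) ^ β * y + (x : ℝ) ^ β * z) ∂η :=
    hm2.comp (measurable_id.prodMk measurable_const)
  have hswap := lintegral_lintegral_swap (μ := (volume : Measure unitInterval)) (ν := δ)
    (f := fun t f₀ => ∫⁻ z, Φ ((1 - (x : ℝ)) ^ β * f₀.1 t + (x : ℝ) ^ β * z) ∂η)
    (hm6.comp (measurable_eval_uncurry.comp measurable_swap)).aemeasurable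
  simp only [hF]
  rw [lintegral_add_left measurable_const, lintegral_const, measure_univ, mul_one,
    lintegral_const_mul' _ _ ENNReal.ofReal_ne_top, hswap, hη, lintegral_evalLaw δ (Φ := fun y =>
      ∫⁻ z, Φ ((1 - (x : ℝ)) ^ β * y + (x : ℝ) ^ β * z) ∂evalLaw δ) hm6]

/-- The mean of `X(ξ)`. -/
def evalMean (δ : Measure CadlagPath) : ℝ := ∫ y, y ∂evalLaw δ

/-- The second moment of `X(ξ)`. -/
def evalSq (δ : Measure CadlagPath) : ENNReal := ∫⁻ y, ‖y‖ₑ ^ 2 ∂evalLaw δ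

/-- The second moment of the supremum norm. -/
def supSq (δ : Measure CadlagPath) : ENNReal := ∫⁻ f, supNorm f ^ 2 ∂δ

lemma evalSq_eq (δ : Measure CadlagPath) : evalSq δ = ∫⁻ f, (∫⁻ t, ‖f.1 t‖ₑ ^ 2) ∂δ :=
  lintegral_evalLaw δ (by fun_prop)

lemma evalSq_le_supSq (δ : Measure CadlagPath) : evalSq δ ≤ supSq δ := by
  rw [evalSq_eq]
  refine lintegral_mono fun f => ?_
  calc ∫⁻ t, ‖f.1 t‖ₑ ^ 2 ≤ ∫⁻ _ : unitInterval, supNorm f ^ 2 :=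
        lintegral_mono fun t => pow_le_pow_left' (enorm_le_supNorm f t) 2
    _ = supNorm f ^ 2 := by simp

lemma memLp_evalLaw {δ : Measure CadlagPath} (h : evalSq δ ≠ ⊤) :
    MemLp (fun y : ℝ => y) 2 (evalLaw δ) := by
  refine ⟨by fun_prop, ?_⟩
  rw [eLpNorm_lt_top_iff_lintegral_rpow_enorm_lt_top (by norm_num) (by norm_num)]
  simpa [evalSq, lt_top_iff_ne_top] using h

lemma integrable_evalLaw {δ : Measure CadlagPath} [IsProbabilityMeasure δ] (h : evalSq δ ≠ ⊤) :
    Integrable (fun y : ℝ => y) (evalLaw δ) :=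
  (memLp_evalLaw h).integrable one_le_two

lemma lintegral_sq_add (η : Measure ℝ) [IsProbabilityMeasure η]
    (h : MemLp (fun y : ℝ => y) 2 η) (h0 : ∫ y, y ∂η = 0) (a b : ℝ) :
    ∫⁻ y, (∫⁻ z, ‖a * y + b * z‖ₑ ^ 2 ∂η) ∂η =
      ENNReal.ofReal (a ^ 2 + b ^ 2) * ∫⁻ y, ‖y‖ₑ ^ 2 ∂η := by
  have hsq : ∀ y : ℝ, ‖y‖ₑ ^ 2 = ENNReal.ofReal (y ^ 2) := fun y => by
    rw [← ofReal_norm, ← ENNReal.ofReal_pow (norm_nonneg _), Real.norm_eq_abs, sq_abs]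
  have hi := h.integrable one_le_two
  have hi2 : Integrable (fun y : ℝ => y ^ 2) η := h.integrable_sq
  have hlin : ∫⁻ y, ENNReal.ofReal (y ^ 2) ∂η = ENNReal.ofReal (∫ y, y ^ 2 ∂η) :=
    (ofReal_integral_eq_lintegral_ofReal hi2 (Eventually.of_forall fun y => sq_nonneg y)).symm
  set m := ∫ y, y ^ 2 ∂η with hm
  have hm0 : 0 ≤ m := integral_nonneg fun y => sq_nonneg y
  simp_rw [hsq]
  have inner : ∀ y, ∫⁻ z, ENNReal.ofReal ((a * y + b * z) ^ 2) ∂η =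
      ENNReal.ofReal (a ^ 2) * ENNReal.ofReal (y ^ 2) + ENNReal.ofReal (b ^ 2 * m) := by
    intro y
    have e : ∀ z, (a * y + b * z) ^ 2 = a ^ 2 * y ^ 2 + (2 * a * b * y) * z + b ^ 2 * z ^ 2 :=
      fun z => by ring
    have hI1 : Integrable (fun z => a ^ 2 * y ^ 2 + (2 * a * b * y) * z) η :=
      (integrable_const _).add (hi.const_mul _)
    have hI2 : Integrable (fun z => b ^ 2 * z ^ 2) η := hi2.const_mul _
    have hI : Integrable (fun z => (a * y + b * z) ^ 2) η := by
      simp_rw [e]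
      exact hI1.add hI2
    rw [← ofReal_integral_eq_lintegral_ofReal hI (Eventually.of_forall fun z => sq_nonneg _)]
    simp_rw [e]
    rw [integral_add hI1 hI2, integral_add (integrable_const _) (hi.const_mul _),
      integral_const, integral_const_mul, integral_const_mul, h0, ← hm,
      ← ENNReal.ofReal_mul (sq_nonneg _),
      ← ENNReal.ofReal_add (by positivity) (by positivity)]
    simp
  simp_rw [inner]
  rw [lintegral_add_right _ measurable_const, lintegral_const_mul' _ _ ENNReal.ofReal_ne_top,
    hlin, lintegral_const, measure_univ, mul_one, ← ENNReal.ofReal_mul (sq_nonneg _),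
    ← ENNReal.ofReal_add (by positivity) (by positivity), ← ENNReal.ofReal_mul (by positivity)]
  ring_nf

lemma evalSq_glueLaw {δ : Measure CadlagPath} [IsProbabilityMeasure δ] (h : evalSq δ ≠ ⊤)
    (h0 : evalMean δ = 0) :
    evalSq (glueLaw δ) =
      ENNReal.ofReal (1 / (β + 1) + (2 / (2 * β + 2) - 2 / (2 * β + 3))) * evalSq δ := by
  have hint : ∫ x, (((1 - (x : ℝ)) ^ β) ^ 2 + (x : ℝ) * ((x : ℝ) ^ β) ^ 2) ∂gapLaw =
      1 / (β + 1) + (2 / (2 * β + 2) - 2 / (2 * β + 3)) := by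
    rw [integral_add (integrable_gapLaw (by fun_prop)) (integrable_gapLaw (by fun_prop)),
      integral_one_sub_sq, integral_mul_sq]
  rw [evalSq, lintegral_evalLaw_glueLaw δ (Φ := fun y => ‖y‖ₑ ^ 2) (by fun_prop), ← hint,
    ← lintegral_gapLaw_ofReal (by fun_prop) fun x => by have := x.2.1; positivity,
    ← lintegral_mul_const' _ _ h]
  refine lintegral_congr fun x => ?_
  have hx0 := x.2.1
  have hx1 : (0 : ℝ) ≤ 1 - x := sub_nonneg.2 x.2.2
  have e1 : ∫⁻ y, ‖(1 - (x : ℝ)) ^ β * y‖ₑ ^ 2 ∂evalLaw δ =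
      ENNReal.ofReal (((1 - (x : ℝ)) ^ β) ^ 2) * evalSq δ := by
    simp_rw [enorm_mul, mul_pow]
    rw [lintegral_const_mul' _ _ (by simp), evalSq, Real.enorm_eq_ofReal
      (one_sub_rpow_β_nonneg x), ENNReal.ofReal_pow (one_sub_rpow_β_nonneg x)]
  rw [e1, lintegral_sq_add _ (memLp_evalLaw h) h0, ← evalSq, ← mul_assoc, ← mul_assoc, ← add_mul,
    ← ENNReal.ofReal_mul hx1, ← ENNReal.ofReal_mul hx0,
    ← ENNReal.ofReal_add (by positivity) (by positivity)]
  ring_nf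

lemma evalLaw_glueLaw_eq (δ : Measure CadlagPath) [IsProbabilityMeasure δ] :
    evalLaw (glueLaw δ) =
      ((gapLaw.withDensity fun x => ENNReal.ofReal (1 - x)).prod (evalLaw δ)).map
        (fun w => (1 - (w.1 : ℝ)) ^ β * w.2) +
      ((gapLaw.withDensity fun x => ENNReal.ofReal x).prod ((evalLaw δ).prod (evalLaw δ))).map
        (fun w => (1 - (w.1 : ℝ)) ^ β * w.2.1 + (w.1 : ℝ) ^ β * w.2.2) := by
  refine Measure.ext_of_lintegral _ fun Φ hΦ => ?_
  have hm1 : Measurable fun w : unitInterval × ℝ => Φ ((1 - (w.1 : ℝ)) ^ β * w.2) := by fun_prop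
  have hm2 : Measurable fun w : unitInterval × ℝ × ℝ =>
      Φ ((1 - (w.1 : ℝ)) ^ β * w.2.1 + (w.1 : ℝ) ^ β * w.2.2) := by fun_prop
  rw [lintegral_evalLaw_glueLaw δ hΦ, lintegral_add_measure, lintegral_map hΦ (by fun_prop),
    lintegral_map hΦ (by fun_prop), lintegral_prod _ hm1.aemeasurable,
    lintegral_prod _ hm2.aemeasurable,
    lintegral_withDensity_eq_lintegral_mul _ (by fun_prop) hm1.lintegral_prod_right',
    lintegral_withDensity_eq_lintegral_mul _ (by fun_prop) hm2.lintegral_prod_right',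
    ← lintegral_add_left ((show Measurable fun x : unitInterval =>
      ENNReal.ofReal (1 - (x : ℝ)) by fun_prop).mul hm1.lintegral_prod_right')]
  refine lintegral_congr fun x => ?_
  have hm3 : Measurable fun w : ℝ × ℝ => Φ ((1 - (x : ℝ)) ^ β * w.1 + (x : ℝ) ^ β * w.2) := by
    fun_prop
  simp only [Pi.mul_apply]
  rw [lintegral_prod _ hm3.aemeasurable]

lemma evalMean_glueLaw {δ : Measure CadlagPath} [IsProbabilityMeasure δ] (h : evalSq δ ≠ ⊤) :
    evalMean (glueLaw δ) = evalMean δ := by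
  have hi := integrable_evalLaw h
  set η := evalLaw δ with hη
  have hf1 : IsFiniteMeasure (gapLaw.withDensity fun x => ENNReal.ofReal (1 - x)) :=
    isFiniteMeasure_withDensity_ofReal (integrable_gapLaw (by fun_prop)).2
  have hf2 : IsFiniteMeasure (gapLaw.withDensity fun x => ENNReal.ofReal x) :=
    isFiniteMeasure_withDensity_ofReal (integrable_gapLaw (by fun_prop)).2
  have hb : ∀ (μ : Measure unitInterval) (g : unitInterval → ℝ), IsFiniteMeasure μ →
      Continuous g → Integrable g μ := fun μ g _ hg =>
    hg.integrable_of_hasCompactSupport (HasCompactSupport.of_compactSpace g)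
  have hI1 : Integrable (fun w : unitInterval × ℝ => (1 - (w.1 : ℝ)) ^ β * w.2)
      ((gapLaw.withDensity fun x => ENNReal.ofReal (1 - x)).prod η) :=
    (hb _ (fun x => (1 - (x : ℝ)) ^ β) hf1 (by fun_prop)).mul_prod hi
  have hI2 : Integrable (fun w : unitInterval × ℝ × ℝ => (1 - (w.1 : ℝ)) ^ β * w.2.1)
      ((gapLaw.withDensity fun x => ENNReal.ofReal x).prod (η.prod η)) :=
    (hb _ (fun x => (1 - (x : ℝ)) ^ β) hf2 (by fun_prop)).mul_prod (hi.comp_fst η)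
  have hI3 : Integrable (fun w : unitInterval × ℝ × ℝ => (w.1 : ℝ) ^ β * w.2.2)
      ((gapLaw.withDensity fun x => ENNReal.ofReal x).prod (η.prod η)) :=
    (hb _ (fun x => (x : ℝ) ^ β) hf2 (by fun_prop)).mul_prod (hi.comp_snd η)
  have hd1 : ∀ g : unitInterval → ℝ,
      ∫ x, g x ∂(gapLaw.withDensity fun x => ENNReal.ofReal (1 - x)) =
        ∫ x, (1 - (x : ℝ)) * g x ∂gapLaw := fun g => by
    rw [integral_withDensity_eq_integral_toReal_smul (by fun_prop)
      (Eventually.of_forall fun _ => ENNReal.ofReal_lt_top)]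
    simp_rw [ENNReal.toReal_ofReal (sub_nonneg.2 (unitInterval.le_one _)), smul_eq_mul]
  have hd2 : ∀ g : unitInterval → ℝ,
      ∫ x, g x ∂(gapLaw.withDensity fun x => ENNReal.ofReal x) =
        ∫ x, (x : ℝ) * g x ∂gapLaw := fun g => by
    rw [integral_withDensity_eq_integral_toReal_smul (by fun_prop)
      (Eventually.of_forall fun _ => ENNReal.ofReal_lt_top)]
    simp_rw [ENNReal.toReal_ofReal (unitInterval.nonneg _), smul_eq_mul]
  have hfst : ∫ w : ℝ × ℝ, w.1 ∂(η.prod η) = ∫ y, y ∂η := by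
    simpa using integral_fun_fst (μ := η) (ν := η) (fun y : ℝ => y)
  have hsnd : ∫ w : ℝ × ℝ, w.2 ∂(η.prod η) = ∫ y, y ∂η := by
    simpa using integral_fun_snd (μ := η) (ν := η) (fun y : ℝ => y)
  rw [evalMean, evalLaw_glueLaw_eq, integral_add_measure, integral_map (by fun_prop) (by fun_prop),
    integral_map (by fun_prop) (by fun_prop), integral_add hI2 hI3,
    integral_prod_mul (fun x : unitInterval => (1 - (x : ℝ)) ^ β) (fun y : ℝ => y),
    integral_prod_mul (fun x : unitInterval => (1 - (x : ℝ)) ^ β) (fun y : ℝ × ℝ => y.1),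
    integral_prod_mul (fun x : unitInterval => (x : ℝ) ^ β) (fun y : ℝ × ℝ => y.2),
    hd1, hd2, hd2, hfst, hsnd, ← add_mul, ← add_mul, ← integral_add, ← integral_add]
  · have : ∀ x : unitInterval, (1 - (x : ℝ)) * (1 - (x : ℝ)) ^ β + ((x : ℝ) * (1 - (x : ℝ)) ^ β +
        (x : ℝ) * (x : ℝ) ^ β) = (1 - (x : ℝ)) ^ β + (x : ℝ) * (x : ℝ) ^ β := fun x => by ring
    simp_rw [this, integral_mean_factor, one_mul]
    rfl
  all_goals first
    | exact integrable_gapLaw (by fun_prop)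
    | exact (integrable_map_measure (by fun_prop) (by fun_prop)).2 hI1
    | exact (integrable_map_measure (by fun_prop) (by fun_prop)).2 (hI2.add hI3)

/-! ### Contraction -/

lemma add_sq_le_weighted (y z : ENNReal) :
    (y + z) ^ 2 ≤ ENNReal.ofReal 11 * y ^ 2 + ENNReal.ofReal 1.1 * z ^ 2 := by
  rcases eq_or_ne y ⊤ with rfl | hy
  · simp
  rcases eq_or_ne z ⊤ with rfl | hz
  · simp [ENNReal.mul_top, show (0 : ℝ) < 1.1 by norm_num]
  lift y to NNReal using hy
  lift z to NNReal using hz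
  have h : ((y : ℝ) + z) ^ 2 ≤ 11 * (y : ℝ) ^ 2 + 1.1 * (z : ℝ) ^ 2 := by
    nlinarith [sq_nonneg (10 * (y : ℝ) - z)]
  have := ENNReal.ofReal_le_ofReal h
  rw [ENNReal.ofReal_add (by positivity) (by positivity), ENNReal.ofReal_mul (by norm_num),
    ENNReal.ofReal_mul (by norm_num), ENNReal.ofReal_pow (by positivity),
    ENNReal.ofReal_pow (by positivity), ENNReal.ofReal_pow (by positivity),
    ENNReal.ofReal_add (by positivity) (by positivity)] at this
  simpa only [ENNReal.ofReal_coe_nnreal] using this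

lemma supNorm_glue_le {p : unitInterval × unitInterval} (hp : p.1 ≤ p.2) (f₀ f₁ : CadlagPath) :
    supNorm (glue p f₀ f₁) ^ 2 ≤
      ENNReal.ofReal (((1 - (gap p : ℝ)) ^ β) ^ 2) * supNorm f₀ ^ 2 +
      (ENNReal.ofReal 11 * (ENNReal.ofReal (((1 - (gap p : ℝ)) ^ β) ^ 2) * ‖f₀.1 (cut p)‖ₑ ^ 2) +
      ENNReal.ofReal 1.1 * (ENNReal.ofReal (((gap p : ℝ) ^ β) ^ 2) * supNorm f₁ ^ 2)) := by
  have hg : (p.2 : ℝ) - p.1 = gap p := (coe_gap hp).symm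
  have ha := one_sub_rpow_β_nonneg (gap p)
  have hb := rpow_β_nonneg (gap p)
  have hea : ∀ r : ℝ, ‖(1 - (gap p : ℝ)) ^ β * r‖ₑ =
      ENNReal.ofReal ((1 - (gap p : ℝ)) ^ β) * ‖r‖ₑ := fun r => by
    rw [enorm_mul, Real.enorm_eq_ofReal ha]
  have heb : ∀ r : ℝ, ‖(gap p : ℝ) ^ β * r‖ₑ = ENNReal.ofReal ((gap p : ℝ) ^ β) * ‖r‖ₑ :=
    fun r => by rw [enorm_mul, Real.enorm_eq_ofReal hb]
  rw [ENNReal.ofReal_pow ha, ENNReal.ofReal_pow hb, ← mul_pow, ← mul_pow, ← mul_pow]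
  rw [supNorm, ENNReal.iSup_pow]
  refine iSup_le fun s => ?_
  have hout : ∀ t, ‖(1 - (gap p : ℝ)) ^ β * f₀.1 t‖ₑ ^ 2 ≤
      (ENNReal.ofReal ((1 - (gap p : ℝ)) ^ β) * supNorm f₀) ^ 2 := fun t => by
    rw [hea]
    gcongr
    exact enorm_le_supNorm f₀ t
  simp only [glue, glueFun]
  rw [hg]
  split_ifs with h1 h2
  · exact (hout _).trans le_self_add
  · refine le_trans ?_ le_add_self
    refine le_trans (pow_le_pow_left' (enorm_add_le _ _) 2) ?_
    refine (add_sq_le_weighted _ _).trans ?_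
    rw [hea, heb]
    have hc : toUnit (p.1 / (1 - (gap p : ℝ))) = cut p := by rw [coe_gap hp]; rfl
    rw [hc]
    gcongr
    exact enorm_le_supNorm f₁ _
  · exact (hout _).trans le_self_add

lemma lintegral_chordLaw_ofReal_gap {g : unitInterval → ℝ} (hg : Continuous g)
    (h0 : ∀ x, 0 ≤ g x) :
    ∫⁻ p, ENNReal.ofReal (g (gap p)) ∂chordLaw = ENNReal.ofReal (∫ x, g x ∂gapLaw) := by
  rw [lintegral_chordLaw_gap (F := fun x => ENNReal.ofReal (g x)) (by fun_prop),
    lintegral_gapLaw_ofReal hg h0]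

lemma supSq_glueLaw_le (δ : Measure CadlagPath) [IsProbabilityMeasure δ] :
    supSq (glueLaw δ) ≤
      ENNReal.ofReal (1 / (β + 1) + 1.1 * (2 / (2 * β + 1) - 2 / (2 * β + 2))) * supSq δ +
      ENNReal.ofReal (11 * (1 / (β + 1))) * evalSq δ := by
  set A : unitInterval → ENNReal := fun x => ENNReal.ofReal (((1 - (x : ℝ)) ^ β) ^ 2) with hA
  set B : unitInterval → ENNReal := fun x => ENNReal.ofReal (((x : ℝ) ^ β) ^ 2) with hB
  have hAm : Measurable A := by fun_prop
  have hBm : Measurable B := by fun_prop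
  set S : unitInterval → ENNReal := fun t => ∫⁻ f : CadlagPath, ‖f.1 t‖ₑ ^ 2 ∂δ with hS
  have hSm : Measurable S :=
    Measurable.lintegral_prod_right' (f := fun q : unitInterval × CadlagPath =>
      ‖q.2.1 q.1‖ₑ ^ 2) (((measurable_eval_uncurry.comp measurable_swap).enorm).pow_const 2)
  have hSint : ∫⁻ t, S t = evalSq δ := by
    rw [evalSq_eq, hS]
    exact lintegral_lintegral_swap
      ((((measurable_eval_uncurry.comp measurable_swap).enorm).pow_const 2).aemeasurable)
  have hAint : ∫⁻ p, A (gap p) ∂chordLaw = ENNReal.ofReal (1 / (β + 1)) := by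
    rw [← integral_one_sub_sq]
    exact lintegral_chordLaw_ofReal_gap (g := fun x => ((1 - (x : ℝ)) ^ β) ^ 2) (by fun_prop)
      fun x => sq_nonneg _
  have hBint : ∫⁻ p, B (gap p) ∂chordLaw =
      ENNReal.ofReal (2 / (2 * β + 1) - 2 / (2 * β + 2)) := by
    rw [← integral_sq]
    exact lintegral_chordLaw_ofReal_gap (g := fun x => ((x : ℝ) ^ β) ^ 2) (by fun_prop)
      fun x => sq_nonneg _
  have hASint : ∫⁻ p, A (gap p) * S (cut p) ∂chordLaw =
      ENNReal.ofReal (1 / (β + 1)) * evalSq δ := by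
    rw [lintegral_chordLaw_gap_cut (F := fun w => A w.1 * S w.2) (by fun_prop), ← hSint,
      ← hAint, lintegral_chordLaw_gap hAm, ← lintegral_mul_const _ hAm]
    exact lintegral_congr fun x => lintegral_const_mul (A x) hSm
  rw [supSq, lintegral_glueLaw _ (by fun_prop)]
  calc ∫⁻ p, (∫⁻ f₀, (∫⁻ f₁, supNorm (glue p f₀ f₁) ^ 2 ∂δ) ∂δ) ∂chordLaw
      ≤ ∫⁻ p, (A (gap p) * supSq δ + (ENNReal.ofReal 11 * (A (gap p) * S (cut p)) +
          ENNReal.ofReal 1.1 * (B (gap p) * supSq δ))) ∂chordLaw := by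
        refine lintegral_mono_ae ?_
        filter_upwards [ae_chordLaw_le] with p hp
        have h1 : ∀ f₀ : CadlagPath, ∫⁻ f₁, supNorm (glue p f₀ f₁) ^ 2 ∂δ ≤
            A (gap p) * supNorm f₀ ^ 2 + (ENNReal.ofReal 11 * (A (gap p) * ‖f₀.1 (cut p)‖ₑ ^ 2) +
              ENNReal.ofReal 1.1 * (B (gap p) * supSq δ)) := by
          intro f₀
          refine (lintegral_mono fun f₁ => supNorm_glue_le hp f₀ f₁).trans ?_
          rw [lintegral_add_left measurable_const, lintegral_const, measure_univ, mul_one,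
            lintegral_add_left measurable_const, lintegral_const, measure_univ, mul_one,
            lintegral_const_mul' _ _ ENNReal.ofReal_ne_top,
            lintegral_const_mul' _ _ ENNReal.ofReal_ne_top, supSq]
        refine (lintegral_mono h1).trans ?_
        rw [lintegral_add_left (by fun_prop), lintegral_add_left (by fun_prop), lintegral_const,
          measure_univ, mul_one, lintegral_const_mul' _ _ ENNReal.ofReal_ne_top,
          lintegral_const_mul' _ _ ENNReal.ofReal_ne_top,
          lintegral_const_mul' _ _ ENNReal.ofReal_ne_top, supSq]
    _ = ENNReal.ofReal (1 / (β + 1)) * supSq δ +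
        (ENNReal.ofReal 11 * (ENNReal.ofReal (1 / (β + 1)) * evalSq δ) +
          ENNReal.ofReal 1.1 *
            (ENNReal.ofReal (2 / (2 * β + 1) - 2 / (2 * β + 2)) * supSq δ)) := by
        rw [lintegral_add_left (by fun_prop), lintegral_add_left (by fun_prop),
          lintegral_mul_const _ (by fun_prop), lintegral_const_mul' _ _ ENNReal.ofReal_ne_top,
          lintegral_const_mul' _ _ ENNReal.ofReal_ne_top, lintegral_mul_const _ (by fun_prop),
          hAint, hBint, hASint]
    _ = _ := by
        have hβ := β_pos
        have h2 : 0 ≤ 2 / (2 * β + 1) - 2 / (2 * β + 2) :=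
          sub_nonneg.2 (div_le_div_of_nonneg_left (by norm_num) (by positivity) (by linarith))
        rw [ENNReal.ofReal_add (by positivity) (by positivity), ENNReal.ofReal_mul (by norm_num),
          ENNReal.ofReal_mul (by norm_num)]
        ring

/-- The functional that `glueLaw` contracts on laws with `evalMean = 0`. -/
def energy (δ : Measure CadlagPath) : ENNReal := supSq δ + ENNReal.ofReal 100 * evalSq δ

lemma supSq_le_energy (δ : Measure CadlagPath) : supSq δ ≤ energy δ := le_self_add

lemma energy_ne_top {δ : Measure CadlagPath} (h : supSq δ ≠ ⊤) : energy δ ≠ ⊤ := by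
  have := ne_top_of_le_ne_top h (evalSq_le_supSq δ)
  exact ENNReal.add_ne_top.2 ⟨h, ENNReal.mul_ne_top ENNReal.ofReal_ne_top this⟩

lemma energy_glueLaw_le {δ : Measure CadlagPath} [IsProbabilityMeasure δ] (h : supSq δ ≠ ⊤)
    (h0 : evalMean δ = 0) : energy (glueLaw δ) ≤ ENNReal.ofReal 0.98 * energy δ := by
  have hβ := le_β
  have hβ1 : 1 / (β + 1) ≤ 0.6411 := by
    rw [div_le_iff₀ (by linarith)]; linarith
  have hq : 1 / (β + 1) + 1.1 * (2 / (2 * β + 1) - 2 / (2 * β + 2)) ≤ 0.98 := by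
    have : 2 / (2 * β + 1) - 2 / (2 * β + 2) = 1 / (β + 1) * (1 / (2 * β + 1)) := by
      field_simp
      ring
    have h3 : 1 / (2 * β + 1) ≤ 0.472 := by
      rw [div_le_iff₀ (by linarith)]; linarith
    have h4 : 0 ≤ 1 / (2 * β + 1) := by positivity
    rw [this]
    nlinarith
  have hq' : 1 / (β + 1) + (2 / (2 * β + 2) - 2 / (2 * β + 3)) ≤ 0.8 := by
    have : 2 / (2 * β + 2) - 2 / (2 * β + 3) = 1 / (β + 1) * (1 / (2 * β + 3)) := by
      field_simp
      ring
    have h3 : 1 / (2 * β + 3) ≤ 0.243 := by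
      rw [div_le_iff₀ (by linarith)]; linarith
    have h4 : 0 ≤ 1 / (2 * β + 3) := by positivity
    rw [this]
    nlinarith
  have hA := ne_top_of_le_ne_top h (evalSq_le_supSq δ)
  calc energy (glueLaw δ)
      ≤ (ENNReal.ofReal 0.98 * supSq δ + ENNReal.ofReal 8 * evalSq δ) +
        ENNReal.ofReal 100 * (ENNReal.ofReal 0.8 * evalSq δ) := by
        rw [energy, evalSq_glueLaw hA h0]
        refine add_le_add ((supSq_glueLaw_le δ).trans ?_) ?_
        · gcongr
          linarith
        · gcongr
    _ = ENNReal.ofReal 0.98 * supSq δ + ENNReal.ofReal 88 * evalSq δ := by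
        rw [← mul_assoc, ← ENNReal.ofReal_mul (by norm_num), add_assoc, ← add_mul,
          ← ENNReal.ofReal_add (by norm_num) (by norm_num)]
        norm_num
    _ ≤ ENNReal.ofReal 0.98 * supSq δ + ENNReal.ofReal 98 * evalSq δ := by
        gcongr
        norm_num
    _ = ENNReal.ofReal 0.98 * energy δ := by
        rw [energy, mul_add, ← mul_assoc, ← ENNReal.ofReal_mul (by norm_num)]
        norm_num

lemma supSq_glueLaw_ne_top {δ : Measure CadlagPath} [IsProbabilityMeasure δ]
    (h : supSq δ ≠ ⊤) : supSq (glueLaw δ) ≠ ⊤ := by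
  refine ne_top_of_le_ne_top ?_ (supSq_glueLaw_le δ)
  exact ENNReal.add_ne_top.2 ⟨ENNReal.mul_ne_top ENNReal.ofReal_ne_top h,
    ENNReal.mul_ne_top ENNReal.ofReal_ne_top (ne_top_of_le_ne_top h (evalSq_le_supSq δ))⟩

/-- Iterating `glueLaw` on a centred law contracts the second moment of the supremum norm. -/
lemma supSq_iterate_le {δ : ℕ → Measure CadlagPath} (hδ : ∀ n, IsProbabilityMeasure (δ n))
    (hstep : ∀ n, δ (n + 1) = glueLaw (δ n)) (h : supSq (δ 0) ≠ ⊤) (h0 : evalMean (δ 0) = 0)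
    (n : ℕ) : supSq (δ n) ≤ ENNReal.ofReal 0.98 ^ n * energy (δ 0) := by
  have key : supSq (δ n) ≠ ⊤ ∧ evalMean (δ n) = 0 ∧
      energy (δ n) ≤ ENNReal.ofReal 0.98 ^ n * energy (δ 0) := by
    induction n with
    | zero => exact ⟨h, h0, by simp⟩
    | succ n ih =>
      obtain ⟨h1, h2, h3⟩ := ih
      rw [hstep]
      refine ⟨supSq_glueLaw_ne_top h1, ?_, (energy_glueLaw_le h1 h2).trans ?_⟩
      · rw [evalMean_glueLaw (ne_top_of_le_ne_top h1 (evalSq_le_supSq _)), h2]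
      · rw [pow_succ', mul_assoc]
        gcongr
  exact (supSq_le_energy _).trans key.2.2

/-! ### Uniform limits of càdlàg paths -/

lemma IsCadlag.of_tendstoUniformly {F : ℕ → unitInterval → ℝ} {f : unitInterval → ℝ}
    (hF : ∀ n, IsCadlag (F n)) (h : TendstoUniformly F f atTop) : IsCadlag f := by
  refine ⟨fun s => ?_, fun s => ?_⟩
  · exact (h.tendstoUniformlyOnFilter.mono_right le_top).tendsto_of_eventually_tendsto
      (Eventually.of_forall fun n => ((hF n).1 s).tendsto) (h.tendsto_at s)
  · rcases eq_or_neBot (𝓝[<] s) with hbot | hbot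
    · exact ⟨0, by rw [hbot]; exact tendsto_bot⟩
    choose L hL using fun n => (hF n).2 s
    have hc : CauchySeq L := by
      refine Metric.cauchySeq_iff'.2 fun ε hε => ?_
      obtain ⟨N, hN⟩ := eventually_atTop.1 (Metric.tendstoUniformly_iff.1 h (ε / 3) (by positivity))
      refine ⟨N, fun n hn => ?_⟩
      have : dist (L n) (L N) ≤ 2 * (ε / 3) := by
        refine le_of_tendsto ((hL n).dist (hL N)) (Eventually.of_forall fun r => ?_)
        have h1 := hN n hn r
        have h2 := hN N le_rfl r
        rw [dist_comm] at h1
        linarith [dist_triangle (F n r) (f r) (F N r)]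
      linarith
    obtain ⟨l, hl⟩ := cauchySeq_tendsto_of_complete hc
    exact ⟨l, (h.tendstoUniformlyOnFilter.mono_right le_top).tendsto_of_eventually_tendsto
      (Eventually.of_forall hL) hl⟩

lemma edist_le_supNorm_diff (f g : CadlagPath) (s : unitInterval) :
    edist (f.1 s) (g.1 s) ≤ supNorm (diff f g) := by
  rw [edist_eq_enorm_sub]
  exact enorm_le_supNorm (diff f g) s

lemma tendstoUniformly_iff_supNorm {F : ℕ → CadlagPath} {f : CadlagPath} :
    TendstoUniformly (fun n => (F n).1) f.1 atTop ↔
      Tendsto (fun n => supNorm (diff (F n) f)) atTop (𝓝 0) := by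
  rw [EMetric.tendstoUniformly_iff, ENNReal.tendsto_nhds_zero]
  refine ⟨fun h ε hε => ?_, fun h ε hε => ?_⟩
  · filter_upwards [h ε hε] with n hn
    refine iSup_le fun s => ?_
    have := (hn s).le
    rwa [edist_comm, edist_eq_enorm_sub] at this
  · obtain ⟨δ, hδ0, hδ⟩ := exists_between hε
    filter_upwards [h δ hδ0] with n hn s
    rw [edist_comm]
    exact ((edist_le_supNorm_diff _ _ s).trans hn).trans_lt hδ

lemma supNorm_diff_comm (f g : CadlagPath) : supNorm (diff f g) = supNorm (diff g f) :=
  iSup_congr fun _ => enorm_sub_rev _ _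

lemma supNorm_diff_triangle (f g k : CadlagPath) :
    supNorm (diff f k) ≤ supNorm (diff f g) + supNorm (diff g k) :=
  iSup_le fun s => by
    have := edist_triangle (f.1 s) (g.1 s) (k.1 s)
    simp only [edist_eq_enorm_sub] at this
    exact this.trans (add_le_add (enorm_le_supNorm (diff f g) s) (enorm_le_supNorm (diff g k) s))

lemma exists_tendstoUniformly_iff (F : ℕ → CadlagPath) :
    (∃ f : CadlagPath, TendstoUniformly (fun n => (F n).1) f.1 atTop) ↔
      ∀ k : ℕ, ∃ N, ∀ n, N ≤ n → supNorm (diff (F n) (F N)) ≤ ((k : ENNReal) + 1)⁻¹ := by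
  constructor
  · rintro ⟨f, hf⟩ k
    rw [tendstoUniformly_iff_supNorm, ENNReal.tendsto_nhds_zero] at hf
    obtain ⟨N, hN⟩ := eventually_atTop.1 (hf (((k : ENNReal) + 1)⁻¹ / 2)
      (ENNReal.div_pos (by simp) (by simp)))
    refine ⟨N, fun n hn => (supNorm_diff_triangle _ f _).trans ?_⟩
    rw [supNorm_diff_comm f]
    exact (add_le_add (hN n hn) (hN N le_rfl)).trans (ENNReal.add_halves _).le
  · intro h
    have hex : ∀ ε : ENNReal, 0 < ε → ∃ N, ∀ n, N ≤ n → supNorm (diff (F n) (F N)) ≤ ε := by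
      intro ε hε
      obtain ⟨k, hk⟩ := ENNReal.exists_inv_nat_lt hε.ne'
      obtain ⟨N, hN⟩ := h k
      refine ⟨N, fun n hn => (hN n hn).trans (le_trans ?_ hk.le)⟩
      exact ENNReal.inv_le_inv.2 le_self_add
    have hU : UniformCauchySeqOn (fun n => (F n).1) atTop Set.univ := by
      intro u hu
      obtain ⟨ε, hε, hεu⟩ := mem_uniformity_edist.1 hu
      obtain ⟨δ, hδ0, hδ⟩ := exists_between (ENNReal.half_pos hε.ne')
      obtain ⟨N, hN⟩ := hex δ hδ0
      filter_upwards [prod_mem_prod (Ici_mem_atTop N) (Ici_mem_atTop N)] with m hm s _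
      refine hεu ?_
      refine (edist_triangle _ ((F N).1 s) _).trans_lt ?_
      have hlt : ∀ n, N ≤ n → edist ((F n).1 s) ((F N).1 s) < ε / 2 := fun n hn =>
        ((edist_le_supNorm_diff _ _ s).trans (hN n hn)).trans_lt hδ
      have h2 := hlt _ hm.2
      rw [edist_comm] at h2
      exact (ENNReal.add_lt_add (hlt _ hm.1) h2).trans_eq (ENNReal.add_halves ε)
    choose f hf using fun s => cauchySeq_tendsto_of_complete (hU.cauchySeq (Set.mem_univ s))
    have hT : TendstoUniformly (fun n => (F n).1) f atTop :=
      tendstoUniformlyOn_univ.1 (hU.tendstoUniformlyOn_of_tendsto fun s _ => hf s)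
    exact ⟨⟨f, IsCadlag.of_tendstoUniformly (fun n => (F n).2) hT⟩, hT⟩

lemma exists_tendstoUniformly_of_tsum {F : ℕ → CadlagPath}
    (h : ∑' n, supNorm (diff (F (n + 1)) (F n)) ≠ ⊤) :
    ∃ f : CadlagPath, TendstoUniformly (fun n => (F n).1) f.1 atTop := by
  rw [exists_tendstoUniformly_iff]
  intro k
  have h0 := ENNReal.tendsto_sum_nat_add _ h
  obtain ⟨N, hN⟩ := (ENNReal.tendsto_nhds_zero.1 h0 ((k : ENNReal) + 1)⁻¹ (by simp)).exists
  refine ⟨N, fun n hn => le_trans ?_ hN⟩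
  obtain ⟨m, rfl⟩ := Nat.exists_eq_add_of_le hn
  refine le_trans ?_ (ENNReal.sum_le_tsum (Finset.range m))
  clear hn
  induction m with
  | zero => simp [supNorm, diff]
  | succ m ih =>
    rw [Finset.sum_range_succ]
    refine ((supNorm_diff_triangle _ (F (N + m)) _).trans (add_le_add le_rfl ih)).trans_eq ?_
    rw [add_comm, add_comm m N, add_assoc]

lemma supNorm_le_add_tsum (F : ℕ → CadlagPath) (n : ℕ) :
    supNorm (F n) ≤ supNorm (F 0) + ∑' n, supNorm (diff (F (n + 1)) (F n)) := by
  refine le_trans ?_ (add_le_add_right (ENNReal.sum_le_tsum (Finset.range n)) _)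
  induction n with
  | zero => simp
  | succ n ih =>
    rw [Finset.sum_range_succ, ← add_assoc]
    refine le_trans (iSup_le fun s => ?_) (add_le_add_left ih _)
    have : (F (n + 1)).1 s = (F n).1 s + (diff (F (n + 1)) (F n)).1 s := by simp [diff]
    rw [this]
    exact (enorm_add_le _ _).trans (add_le_add (enorm_le_supNorm _ s) (enorm_le_supNorm _ s))

lemma supNorm_le_of_tendstoUniformly {F : ℕ → CadlagPath} {f : CadlagPath}
    (h : TendstoUniformly (fun n => (F n).1) f.1 atTop) {C : ENNReal}
    (hC : ∀ n, supNorm (F n) ≤ C) : supNorm f ≤ C :=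
  iSup_le fun s => le_of_tendsto (h.tendsto_at s).enorm
    (Eventually.of_forall fun n => (enorm_le_supNorm _ s).trans (hC n))

/-! ### The limit path -/

/-- Families of chords indexed by the nodes of the binary tree. -/
abbrev Chords : Type := List Bool → unitInterval × unitInterval

lemma limitPath_eq {p : Chords} {f : CadlagPath}
    (h : TendstoUniformly (fun n => (approx p n []).1) f.1 atTop) : limitPath p = f := by
  have hex : ∃ f : CadlagPath, TendstoUniformly (fun n => (approx p n []).1) f.1 atTop := ⟨f, h⟩
  rw [limitPath, dif_pos hex]
  exact Subtype.ext (funext fun s =>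
    tendsto_nhds_unique (hex.choose_spec.tendsto_at s) (h.tendsto_at s))

lemma tendstoUniformly_limitPath {p : Chords}
    (h : ∃ f : CadlagPath, TendstoUniformly (fun n => (approx p n []).1) f.1 atTop) :
    TendstoUniformly (fun n => (approx p n []).1) (limitPath p).1 atTop := by
  rw [limitPath, dif_pos h]
  exact h.choose_spec

@[fun_prop]
lemma measurable_approx (n : ℕ) (w : List Bool) :
    Measurable fun p : Chords => approx p n w := by
  induction n generalizing w with
  | zero => exact measurable_const
  | succ n ih => exact measurable_glue (measurable_pi_apply w) (ih _) (ih _)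

lemma measurable_limitPath : Measurable fun p : Chords => limitPath p := by
  classical
  set E : Set Chords :=
    {p | ∃ f : CadlagPath, TendstoUniformly (fun n => (approx p n []).1) f.1 atTop} with hE
  have hEm : MeasurableSet E := by
    have : E = ⋂ k : ℕ, ⋃ N : ℕ, ⋂ n : ℕ, ⋂ _ : N ≤ n,
        {p | supNorm (diff (approx p n []) (approx p N [])) ≤ ((k : ENNReal) + 1)⁻¹} := by
      ext p
      simp only [Set.mem_iInter, Set.mem_iUnion]
      exact exists_tendstoUniformly_iff _
    rw [this]
    refine MeasurableSet.iInter fun k => MeasurableSet.iUnion fun N => MeasurableSet.iInter fun n =>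
      MeasurableSet.iInter fun _ => ?_
    exact measurableSet_le (measurable_supNorm.comp
      (measurable_diff (measurable_approx n []) (measurable_approx N []))) measurable_const
  refine measurable_path_iff.2 fun s => ?_
  refine measurable_of_tendsto_metrizable (f := fun n => E.indicator fun p => (approx p n []).1 s)
    (fun n => ((measurable_eval s).comp (measurable_approx n [])).indicator hEm)
    (tendsto_pi_nhds.2 fun p => ?_)
  by_cases hp : p ∈ E
  · simp only [Set.indicator_of_mem hp]
    exact (tendstoUniformly_limitPath hp).tendsto_at s
  · simp only [Set.indicator_of_notMem hp]
    have : limitPath p = ⟨fun _ => 0, IsCadlag.of_continuous continuous_const⟩ := dif_neg hp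
    rw [this]
    exact tendsto_const_nhds

/-! ### Continuity -/

lemma continuous_glueFun {u v : unitInterval} (h : u ≤ v) {f₀ f₁ : unitInterval → ℝ}
    (h₀ : Continuous f₀) (h₁ : Continuous f₁) (hz : f₁ 0 = 0) (ho : f₁ 1 = 0) :
    Continuous (glueFun u v f₀ f₁) := by
  have huv : (u : ℝ) ≤ v := h
  have he : glueFun u v f₀ f₁ = fun s : unitInterval => if (u : ℝ) ≤ s then (if (v : ℝ) ≤ s then
      (1 - ((v : ℝ) - u)) ^ β * f₀ (toUnit ((s - ((v : ℝ) - u)) / (1 - ((v : ℝ) - u)))) else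
      (1 - ((v : ℝ) - u)) ^ β * f₀ (toUnit (u / (1 - ((v : ℝ) - u)))) +
      ((v : ℝ) - u) ^ β * f₁ (toUnit ((s - u) / ((v : ℝ) - u)))) else
      (1 - ((v : ℝ) - u)) ^ β * f₀ (toUnit (s / (1 - ((v : ℝ) - u)))) := by
    funext s
    simp only [glueFun, ← not_le, ite_not]
  have ht := continuous_toUnit
  have hend : ((v : ℝ) - u) ^ β * f₁ (toUnit (((v : ℝ) - u) / ((v : ℝ) - u))) = 0 := by
    rcases eq_or_ne ((v : ℝ) - u) 0 with h0 | h0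
    · rw [h0, Real.zero_rpow β_pos.ne', zero_mul]
    · have : toUnit 1 = 1 := toUnit_coe 1
      rw [div_self h0, this, ho, mul_zero]
  rw [he]
  refine Continuous.if_le (Continuous.if_le ?_ ?_ (by fun_prop) (by fun_prop) ?_) ?_ (by fun_prop)
    (by fun_prop) ?_
  · exact continuous_const.mul (h₀.comp (ht.comp (by fun_prop)))
  · exact continuous_const.add (continuous_const.mul (h₁.comp (ht.comp (by fun_prop))))
  · intro s hs
    rw [← hs, hend, add_zero, sub_sub_cancel]
  · exact continuous_const.mul (h₀.comp (ht.comp (by fun_prop)))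
  · intro s hs
    rw [← hs]
    split_ifs with hvs
    · have : (v : ℝ) - u = 0 := by linarith
      rw [this, sub_zero, sub_zero]
    · have : toUnit 0 = 0 := toUnit_coe 0
      rw [sub_self, zero_div, this, hz, mul_zero, add_zero]

lemma glueFun_zero {u v : unitInterval} (h : u ≤ v) {f₀ f₁ : unitInterval → ℝ} (h₀ : f₀ 0 = 0)
    (h₁ : f₁ 0 = 0) : glueFun u v f₀ f₁ 0 = 0 := by
  have huv : (u : ℝ) ≤ v := h
  have hu := u.2.1
  have ht : toUnit 0 = 0 := toUnit_coe 0
  simp only [glueFun, Set.Icc.coe_zero]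
  split_ifs with h1 h2
  · rw [zero_div, ht, h₀, mul_zero]
  · have : (u : ℝ) = 0 := by linarith
    rw [this, sub_self, zero_div, zero_div, ht, h₀, h₁, mul_zero, mul_zero, add_zero]
  · have : (u : ℝ) = 0 := by linarith
    have : (v : ℝ) = 0 := by linarith
    simp [*]

lemma glueFun_one {u v : unitInterval} {f₀ f₁ : unitInterval → ℝ} (h₀ : f₀ 1 = 0) :
    glueFun u v f₀ f₁ 1 = 0 := by
  have hu := u.2.2
  have hv := v.2.2
  have ht : toUnit 1 = 1 := toUnit_coe 1
  simp only [glueFun, Set.Icc.coe_one, if_neg (not_lt.2 hu), if_neg (not_lt.2 hv)]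
  rcases eq_or_ne (1 - ((v : ℝ) - u)) 0 with h0 | h0
  · rw [h0, Real.zero_rpow β_pos.ne', zero_mul]
  · rw [div_self h0, ht, h₀, mul_zero]

lemma continuous_initialPath : Continuous initialPath.1 :=
  continuous_const.mul
    ((show Continuous fun s : unitInterval => (s : ℝ) * (1 - s) by fun_prop).rpow_const
      fun _ => Or.inr β_nonneg)

lemma approx_continuous {p : Chords} (hp : ∀ w, (p w).1 ≤ (p w).2) (n : ℕ) (w : List Bool) :
    Continuous (approx p n w).1 ∧ (approx p n w).1 0 = 0 ∧ (approx p n w).1 1 = 0 := by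
  induction n generalizing w with
  | zero =>
    refine ⟨continuous_initialPath, ?_, ?_⟩ <;>
    simp [approx, initialPath, Real.zero_rpow β_pos.ne']
  | succ n ih =>
    obtain ⟨a1, a2, a3⟩ := ih (w ++ [false])
    obtain ⟨b1, b2, b3⟩ := ih (w ++ [true])
    exact ⟨continuous_glueFun (hp w) a1 b1 b2 b3, glueFun_zero (hp w) a2 b2, glueFun_one a3⟩

/-! ### The law of the chords and its recursive decomposition -/

/-- The law of a family of independent random chords indexed by the nodes of the tree. -/
def treeLaw : Measure Chords := Measure.infinitePi fun _ => chordLaw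

instance : IsProbabilityMeasure treeLaw := by unfold treeLaw; infer_instance

/-- The chords of the subtree rooted at a child of the root. -/
def subtree (b : Bool) (p : Chords) : Chords := fun w => p (b :: w)

@[fun_prop]
lemma measurable_subtree (b : Bool) : Measurable (subtree b) :=
  measurable_pi_iff.2 fun w => measurable_pi_apply (b :: w)

/-- The family of chords with a given root and given subtrees. -/
def graft (q : (unitInterval × unitInterval) × Chords × Chords) : Chords
  | [] => q.1
  | false :: w => q.2.1 w
  | true :: w => q.2.2 w

lemma measurable_graft : Measurable graft := by
  refine measurable_pi_iff.2 fun w => ?_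
  match w with
  | [] => exact measurable_fst
  | false :: w => exact (measurable_pi_apply w).comp (measurable_fst.comp measurable_snd)
  | true :: w => exact (measurable_pi_apply w).comp (measurable_snd.comp measurable_snd)

lemma map_graft : (chordLaw.prod (treeLaw.prod treeLaw)).map graft = treeLaw := by
  classical
  refine Measure.eq_infinitePi _ fun s t ht => ?_
  set t' : List Bool → Set (unitInterval × unitInterval) :=
    fun w => if w ∈ s then t w else Set.univ with ht'
  have ht'm : ∀ w, MeasurableSet (t' w) := fun w => by
    simp only [ht']
    split_ifs
    exacts [ht w, MeasurableSet.univ]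
  set s₀ : Finset (List Bool) := s.image List.tail with hs₀
  set s' : Finset (List Bool) :=
    insert [] (s₀.image (List.cons false) ∪ s₀.image (List.cons true)) with hs'
  have hsub : s ⊆ s' := by
    intro w hw
    have hw' : w.tail ∈ s₀ := Finset.mem_image_of_mem _ hw
    match w with
    | [] => simp [hs']
    | false :: w => simpa [hs'] using hw'
    | true :: w => simpa [hs'] using hw'
  have hpre : graft ⁻¹' (Set.pi s t) = t' [] ×ˢ (Set.pi s₀ (fun w => t' (false :: w)) ×ˢ
      Set.pi s₀ (fun w => t' (true :: w))) := by
    have h1 : Set.pi (s : Set (List Bool)) t = Set.pi (s' : Set (List Bool)) t' := by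
      ext p
      simp only [Set.mem_pi, Finset.mem_coe, ht']
      refine ⟨fun h w _ => ?_, fun h w hw => ?_⟩
      · split_ifs with hw
        exacts [h w hw, trivial]
      · have := h w (hsub hw)
        rwa [if_pos hw] at this
    rw [h1]
    ext q
    simp only [Set.mem_preimage, Set.mem_pi, Finset.mem_coe, Set.mem_prod, hs',
      Finset.mem_insert, Finset.mem_union, Finset.mem_image]
    constructor
    · intro h
      exact ⟨h [] (Or.inl rfl), fun w hw => h (false :: w) (Or.inr (Or.inl ⟨w, hw, rfl⟩)),
        fun w hw => h (true :: w) (Or.inr (Or.inr ⟨w, hw, rfl⟩))⟩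
    · rintro ⟨h1, h2, h3⟩ w (rfl | ⟨w, hw, rfl⟩ | ⟨w, hw, rfl⟩)
      exacts [h1, h2 w hw, h3 w hw]
  rw [Measure.map_apply measurable_graft (MeasurableSet.pi s.countable_toSet fun w _ => ht w),
    hpre, Measure.prod_prod, Measure.prod_prod, treeLaw,
    Measure.infinitePi_pi _ fun w _ => ht'm _, Measure.infinitePi_pi _ fun w _ => ht'm _]
  have hprod : ∏ w ∈ s, chordLaw (t w) = ∏ w ∈ s', chordLaw (t' w) := by
    rw [← Finset.prod_subset hsub fun w _ hw => by simp [ht', hw]]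
    exact Finset.prod_congr rfl fun w hw => by simp [ht', hw]
  clear_value s₀
  rw [hprod, hs', Finset.prod_insert (by simp), Finset.prod_union, Finset.prod_image,
    Finset.prod_image]
  · simp
  · simp
  · rw [Finset.disjoint_left]
    simp only [Finset.mem_image]
    rintro _ ⟨w, _, rfl⟩ ⟨w', _, h⟩
    exact absurd (List.cons.inj h).1 (by decide)

lemma measurable_split :
    Measurable fun p : Chords => (p [], subtree false p, subtree true p) :=
  (measurable_pi_apply []).prodMk ((measurable_subtree false).prodMk (measurable_subtree true))

lemma map_split :
    treeLaw.map (fun p => (p [], subtree false p, subtree true p)) =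
      chordLaw.prod (treeLaw.prod treeLaw) := by
  conv_lhs => rw [← map_graft]
  rw [Measure.map_map measurable_split measurable_graft]
  exact Measure.map_id

lemma measurePreserving_subtree (b : Bool) : MeasurePreserving (subtree b) treeLaw treeLaw := by
  refine ⟨measurable_subtree b, ?_⟩
  have h := map_split
  match b with
  | false =>
    have := congrArg (fun μ => μ.map fun q => q.2.1) h
    beta_reduce at this
    rw [Measure.map_map (by fun_prop) measurable_split] at this
    refine this.trans ?_
    change Measure.map (Prod.fst ∘ Prod.snd) _ = _
    rw [← Measure.map_map measurable_fst measurable_snd]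
    simp
  | true =>
    have := congrArg (fun μ => μ.map fun q => q.2.2) h
    beta_reduce at this
    rw [Measure.map_map (by fun_prop) measurable_split] at this
    refine this.trans ?_
    change Measure.map (Prod.snd ∘ Prod.snd) _ = _
    rw [← Measure.map_map measurable_snd measurable_snd]
    simp

lemma map_treeLaw_glue {Y : Chords → CadlagPath} (hY : Measurable Y) :
    treeLaw.map (fun p => glue (p []) (Y (subtree false p)) (Y (subtree true p))) =
      glueLaw (treeLaw.map Y) := by
  have h2 : Measurable (Prod.map Y Y) := hY.prodMap hY
  rw [glueLaw, Measure.map_prod_map _ _ hY hY]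
  conv_rhs => rw [← Measure.map_id (μ := chordLaw)]
  rw [Measure.map_prod_map _ _ measurable_id h2,
    Measure.map_map measurable_glue_prod (measurable_id.prodMap h2), ← map_split,
    Measure.map_map (measurable_glue_prod.comp (measurable_id.prodMap h2)) measurable_split]
  rfl

lemma approx_cons (p : Chords) (b : Bool) (n : ℕ) (w : List Bool) :
    approx p n (b :: w) = approx (subtree b p) n w := by
  induction n generalizing w with
  | zero => rfl
  | succ n ih =>
    simp only [approx, List.cons_append, ih]
    rfl

lemma approx_succ_root (p : Chords) (n : ℕ) :
    approx p (n + 1) [] =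
      glue (p []) (approx (subtree false p) n []) (approx (subtree true p) n []) := by
  simp only [approx, List.nil_append, approx_cons]

/-- The law of the approximation at the root after `n` steps. -/
def approxLaw (n : ℕ) : Measure CadlagPath := treeLaw.map fun p => approx p n []

/-- The law of the increment between the approximations after `n` and `n + 1` steps. -/
def incrLaw (n : ℕ) : Measure CadlagPath :=
  treeLaw.map fun p => diff (approx p (n + 1) []) (approx p n [])

instance (n : ℕ) : IsProbabilityMeasure (approxLaw n) :=
  Measure.isProbabilityMeasure_map (measurable_approx n []).aemeasurable

lemma measurable_incr (n : ℕ) :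
    Measurable fun p : Chords => diff (approx p (n + 1) []) (approx p n []) :=
  measurable_diff (measurable_approx _ []) (measurable_approx n [])

instance (n : ℕ) : IsProbabilityMeasure (incrLaw n) :=
  Measure.isProbabilityMeasure_map (measurable_incr n).aemeasurable

lemma approxLaw_succ (n : ℕ) : approxLaw (n + 1) = glueLaw (approxLaw n) := by
  rw [approxLaw, approxLaw, ← map_treeLaw_glue (measurable_approx n [])]
  simp only [approx_succ_root]

lemma incrLaw_succ (n : ℕ) : incrLaw (n + 1) = glueLaw (incrLaw n) := by
  rw [incrLaw, incrLaw, ← map_treeLaw_glue (measurable_incr n)]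
  simp only [glue_diff, ← approx_succ_root]

/-! ### Moments of the increments -/

lemma supSq_map {Ω : Type*} [MeasurableSpace Ω] (P : Measure Ω) {X : Ω → CadlagPath}
    (hX : Measurable X) : supSq (P.map X) = ∫⁻ ω, supNorm (X ω) ^ 2 ∂P :=
  lintegral_map (by fun_prop) hX

lemma evalLaw_map {Ω : Type*} [MeasurableSpace Ω] (P : Measure Ω) [SFinite P]
    {X : Ω → CadlagPath} (hX : Measurable X) :
    evalLaw (P.map X) = (P.prod volume).map fun w : Ω × unitInterval => (X w.1).1 w.2 := by
  rw [evalLaw]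
  conv_lhs => rw [← Measure.map_id (μ := (volume : Measure unitInterval))]
  rw [Measure.map_prod_map _ _ hX measurable_id,
    Measure.map_map measurable_eval_uncurry (hX.prodMap measurable_id)]
  rfl

lemma measurable_eval_prod {Ω : Type*} [MeasurableSpace Ω] {X : Ω → CadlagPath}
    (hX : Measurable X) : Measurable fun w : Ω × unitInterval => (X w.1).1 w.2 :=
  measurable_eval_path (hX.comp measurable_fst) measurable_snd

lemma evalMean_map {Ω : Type*} [MeasurableSpace Ω] (P : Measure Ω) [SFinite P]
    {X : Ω → CadlagPath} (hX : Measurable X) :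
    evalMean (P.map X) = ∫ w : Ω × unitInterval, (X w.1).1 w.2 ∂(P.prod volume) := by
  rw [evalMean, evalLaw_map P hX,
    integral_map (measurable_eval_prod hX).aemeasurable (by fun_prop)]

lemma integrable_eval {Ω : Type*} [MeasurableSpace Ω] (P : Measure Ω) [IsProbabilityMeasure P]
    {X : Ω → CadlagPath} (hX : Measurable X) (h : supSq (P.map X) ≠ ⊤) :
    Integrable (fun w : Ω × unitInterval => (X w.1).1 w.2) (P.prod volume) := by
  have : IsProbabilityMeasure (P.map X) := Measure.isProbabilityMeasure_map hX.aemeasurable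
  have hi := integrable_evalLaw (ne_top_of_le_ne_top h (evalSq_le_supSq _))
  rw [evalLaw_map P hX] at hi
  exact (integrable_map_measure (by fun_prop) (measurable_eval_prod hX).aemeasurable).1 hi

lemma evalMean_diff {Ω : Type*} [MeasurableSpace Ω] (P : Measure Ω) [IsProbabilityMeasure P]
    {X Y : Ω → CadlagPath} (hX : Measurable X) (hY : Measurable Y)
    (h : supSq (P.map X) ≠ ⊤) (h' : supSq (P.map Y) ≠ ⊤) :
    evalMean (P.map fun ω => diff (X ω) (Y ω)) = evalMean (P.map X) - evalMean (P.map Y) := by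
  rw [evalMean_map P (measurable_diff hX hY), evalMean_map P hX, evalMean_map P hY,
    ← integral_sub (integrable_eval P hX h) (integrable_eval P hY h')]
  rfl

lemma supSq_diff_ne_top {Ω : Type*} [MeasurableSpace Ω] (P : Measure Ω)
    {X Y : Ω → CadlagPath} (hX : Measurable X) (hY : Measurable Y)
    (h : supSq (P.map X) ≠ ⊤) (h' : supSq (P.map Y) ≠ ⊤) :
    supSq (P.map fun ω => diff (X ω) (Y ω)) ≠ ⊤ := by
  rw [supSq_map P hX] at h
  rw [supSq_map P hY] at h'
  rw [supSq_map P (measurable_diff hX hY)]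
  refine ne_top_of_le_ne_top ?_ (lintegral_mono fun ω =>
    (pow_le_pow_left' (supNorm_diff_le (X ω) (Y ω)) 2).trans (add_sq_le_weighted _ _))
  have hm : Measurable fun ω => ENNReal.ofReal 11 * supNorm (X ω) ^ 2 := by fun_prop
  rw [lintegral_add_left hm,
    lintegral_const_mul' _ _ ENNReal.ofReal_ne_top, lintegral_const_mul' _ _ ENNReal.ofReal_ne_top]
  exact ENNReal.add_ne_top.2 ⟨ENNReal.mul_ne_top ENNReal.ofReal_ne_top h,
    ENNReal.mul_ne_top ENNReal.ofReal_ne_top h'⟩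

lemma supNorm_initialPath_ne_top : supNorm initialPath ≠ ⊤ := by
  refine ne_top_of_le_ne_top (enorm_ne_top (x := κ)) (iSup_le fun s => ?_)
  have h0 : 0 ≤ (s : ℝ) * (1 - s) := mul_nonneg s.2.1 (sub_nonneg.2 s.2.2)
  have h1 : (s : ℝ) * (1 - s) ≤ 1 := by nlinarith [s.2.1, s.2.2]
  rw [initialPath, enorm_mul]
  refine mul_le_of_le_one_right' ?_
  rw [Real.enorm_eq_ofReal (Real.rpow_nonneg h0 _), ENNReal.ofReal_le_one]
  exact Real.rpow_le_one h0 h1 β_nonneg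

lemma supSq_approxLaw_ne_top (n : ℕ) : supSq (approxLaw n) ≠ ⊤ := by
  induction n with
  | zero =>
    rw [approxLaw, supSq_map _ (measurable_approx 0 [])]
    simpa [approx] using supNorm_initialPath_ne_top
  | succ n ih =>
    rw [approxLaw_succ]
    exact supSq_glueLaw_ne_top ih

lemma evalMean_approxLaw (n : ℕ) :
    evalMean (approxLaw n) = κ * betaFn (β + 1) (β + 1) := by
  induction n with
  | zero =>
    rw [approxLaw, evalMean_map _ (measurable_approx 0 [])]
    simp only [approx, initialPath]
    have := integral_fun_snd (μ := treeLaw) (ν := (volume : Measure unitInterval))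
      fun s => κ * ((s : ℝ) * (1 - s)) ^ β
    rw [this, integral_unitInterval fun s => κ * (s * (1 - s)) ^ β, betaFn,
      intervalIntegral.integral_const_mul]
    simp only [probReal_univ, one_smul, add_sub_cancel_right]
    congr 1
    refine intervalIntegral.integral_congr fun x hx => ?_
    rw [Set.uIcc_of_le zero_le_one] at hx
    exact Real.mul_rpow hx.1 (sub_nonneg.2 hx.2)
  | succ n ih =>
    rw [approxLaw_succ, evalMean_glueLaw
      (ne_top_of_le_ne_top (supSq_approxLaw_ne_top n) (evalSq_le_supSq _)), ih]

lemma exists_supSq_incrLaw_le :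
    ∃ C : ENNReal, C ≠ ⊤ ∧ ∀ n, supSq (incrLaw n) ≤ ENNReal.ofReal 0.98 ^ n * C := by
  have h : supSq (incrLaw 0) ≠ ⊤ := supSq_diff_ne_top _ (measurable_approx 1 [])
    (measurable_approx 0 []) (supSq_approxLaw_ne_top 1) (supSq_approxLaw_ne_top 0)
  refine ⟨energy (incrLaw 0), energy_ne_top h, supSq_iterate_le inferInstance incrLaw_succ h ?_⟩
  have := evalMean_diff treeLaw (measurable_approx 1 []) (measurable_approx 0 [])
    (supSq_approxLaw_ne_top 1) (supSq_approxLaw_ne_top 0)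
  refine this.trans ?_
  exact sub_eq_zero.2 ((evalMean_approxLaw 1).trans (evalMean_approxLaw 0).symm)

/-! ### Convergence of the approximations -/

lemma sq_tsum_le (x : ℕ → ENNReal) {r : ENNReal} (h0 : r ≠ 0) (ht : r ≠ ⊤) :
    (∑' n, x n) ^ 2 ≤ (∑' n, r ^ n) * ∑' n, r⁻¹ ^ n * x n ^ 2 := by
  have hsq : ∀ y : ENNReal, (y ^ (1 / 2 : ℝ)) ^ (2 : ℝ) = y := fun y => by
    rw [← ENNReal.rpow_mul]; norm_num
  have h := ENNReal.lintegral_mul_le_Lp_mul_Lq (Measure.count : Measure ℕ)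
    Real.HolderConjugate.two_two (f := fun n => (r ^ n) ^ (1 / 2 : ℝ))
    (g := fun n => (r⁻¹ ^ n * x n ^ 2) ^ (1 / 2 : ℝ)) (by fun_prop) (by fun_prop)
  simp only [lintegral_count, Pi.mul_apply, hsq,
    ← ENNReal.mul_rpow_of_nonneg _ _ (show (0 : ℝ) ≤ 1 / 2 by norm_num), ← mul_assoc, ← mul_pow,
    ENNReal.mul_inv_cancel h0 ht, one_pow, one_mul] at h
  have hx : ∀ n, (x n ^ 2) ^ (1 / 2 : ℝ) = x n := fun n => by
    rw [← ENNReal.rpow_natCast, ← ENNReal.rpow_mul]; norm_num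
  simp only [hx] at h
  refine (pow_le_pow_left' h 2).trans_eq ?_
  rw [← ENNReal.rpow_natCast]
  exact hsq _

/-- The sum of the supremum norms of the increments at the root. -/
def incrSum (p : Chords) : ENNReal :=
  ∑' n, supNorm (diff (approx p (n + 1) []) (approx p n []))

lemma measurable_incrSum : Measurable incrSum :=
  Measurable.tsum fun n => measurable_supNorm.comp (measurable_incr n)

lemma lintegral_incrSum_sq_ne_top : ∫⁻ p, incrSum p ^ 2 ∂treeLaw ≠ ⊤ := by
  obtain ⟨C, hC, hle⟩ := exists_supSq_incrLaw_le
  set r : ENNReal := ENNReal.ofReal 0.99 with hr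
  have hr0 : r ≠ 0 := by simp [hr]; norm_num
  have hr1 : r < 1 := by rw [hr, ENNReal.ofReal_lt_one]; norm_num
  have hrt : r ≠ ⊤ := ENNReal.ofReal_ne_top
  have hq : r⁻¹ * ENNReal.ofReal 0.98 < 1 := by
    rw [hr, ← ENNReal.ofReal_inv_of_pos (by norm_num), ← ENNReal.ofReal_mul (by norm_num),
      ENNReal.ofReal_lt_one]
    norm_num
  have hgeom : ∀ q : ENNReal, q < 1 → ∑' n, q ^ n ≠ ⊤ := fun q hq => by
    rw [ENNReal.tsum_geometric]
    exact ENNReal.inv_ne_top.2 (tsub_pos_of_lt hq).ne'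
  refine ne_top_of_le_ne_top ?_ (lintegral_mono fun p => sq_tsum_le _ hr0 hrt)
  have hm : ∀ n, Measurable fun p : Chords =>
      r⁻¹ ^ n * supNorm (diff (approx p (n + 1) []) (approx p n [])) ^ 2 := fun n =>
    ((measurable_supNorm.comp (measurable_incr n)).pow_const 2).const_mul _
  rw [lintegral_const_mul' _ _ (hgeom r hr1), lintegral_tsum fun n => (hm n).aemeasurable]
  refine ENNReal.mul_ne_top (hgeom r hr1) ?_
  have hb : ∀ n, ∫⁻ p, r⁻¹ ^ n * supNorm (diff (approx p (n + 1) []) (approx p n [])) ^ 2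
      ∂treeLaw ≤ (r⁻¹ * ENNReal.ofReal 0.98) ^ n * C := fun n => by
    rw [lintegral_const_mul' _ _ (ENNReal.pow_ne_top (ENNReal.inv_ne_top.2 hr0)),
      ← supSq_map treeLaw (measurable_incr n), mul_pow, mul_assoc]
    gcongr
    exact hle n
  refine ne_top_of_le_ne_top ?_ (ENNReal.tsum_le_tsum hb)
  rw [ENNReal.tsum_mul_right]
  exact ENNReal.mul_ne_top (hgeom _ hq) hC

/-- A bound for the supremum norms of all approximations at the root. -/
def supBound (p : Chords) : ENNReal := supNorm initialPath + incrSum p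

lemma measurable_supBound : Measurable supBound := measurable_incrSum.const_add _

lemma supNorm_approx_le (p : Chords) (n : ℕ) : supNorm (approx p n []) ≤ supBound p :=
  supNorm_le_add_tsum (fun n => approx p n []) n

lemma lintegral_supBound_sq_ne_top : ∫⁻ p, supBound p ^ 2 ∂treeLaw ≠ ⊤ := by
  refine ne_top_of_le_ne_top ?_ (lintegral_mono fun p => add_sq_le_weighted _ _)
  rw [lintegral_add_left measurable_const, lintegral_const, measure_univ, mul_one,
    lintegral_const_mul' _ _ ENNReal.ofReal_ne_top]
  exact ENNReal.add_ne_top.2 ⟨ENNReal.mul_ne_top ENNReal.ofReal_ne_top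
    (ENNReal.pow_ne_top supNorm_initialPath_ne_top),
    ENNReal.mul_ne_top ENNReal.ofReal_ne_top lintegral_incrSum_sq_ne_top⟩

lemma lintegral_supBound_ne_top : ∫⁻ p, supBound p ∂treeLaw ≠ ⊤ := by
  have h : ∀ x : ENNReal, x ≤ 1 + x ^ 2 := fun x => by
    rcases le_total x 1 with hx | hx
    · exact hx.trans le_self_add
    · exact (le_self_pow₀ hx two_ne_zero).trans le_add_self
  refine ne_top_of_le_ne_top ?_ (lintegral_mono fun p => h _)
  rw [lintegral_add_left measurable_const]
  exact ENNReal.add_ne_top.2 ⟨by simp, lintegral_supBound_sq_ne_top⟩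

lemma ae_tendstoUniformly : ∀ᵐ p ∂treeLaw,
    TendstoUniformly (fun n => (approx p n []).1) (limitPath p).1 atTop := by
  filter_upwards [ae_lt_top measurable_supBound lintegral_supBound_ne_top] with p hp
  exact tendstoUniformly_limitPath
    (exists_tendstoUniformly_of_tsum (ne_top_of_le_ne_top hp.ne le_add_self))

lemma ae_treeLaw_le : ∀ᵐ p ∂treeLaw, ∀ w, (p w).1 ≤ (p w).2 := by
  refine ae_all_iff.2 fun w => ?_
  exact (measurePreserving_eval_infinitePi (fun _ : List Bool => chordLaw)
    w).quasiMeasurePreserving.ae ae_chordLaw_le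

lemma ae_continuous_limitPath : ∀ᵐ p ∂treeLaw, Continuous (limitPath p).1 := by
  filter_upwards [ae_tendstoUniformly, ae_treeLaw_le] with p hp hle
  exact hp.continuous (Frequently.of_forall fun n => (approx_continuous hle n []).1)

/-! ### The limit solves the fixed-point equation -/

/-- The law of the limit path. -/
def limitLaw : Measure CadlagPath := treeLaw.map limitPath

lemma supSq_limitLaw_ne_top : supSq limitLaw ≠ ⊤ := by
  rw [limitLaw, supSq_map _ measurable_limitPath]
  refine ne_top_of_le_ne_top lintegral_supBound_sq_ne_top (lintegral_mono_ae ?_)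
  filter_upwards [ae_tendstoUniformly] with p hp
  exact pow_le_pow_left' (supNorm_le_of_tendstoUniformly hp (supNorm_approx_le p)) 2

lemma evalMean_limitLaw : evalMean limitLaw = κ * betaFn (β + 1) (β + 1) := by
  have hae : ∀ᵐ w ∂treeLaw.prod (volume : Measure unitInterval),
      Tendsto (fun n => (approx w.1 n []).1 w.2) atTop (𝓝 ((limitPath w.1).1 w.2)) := by
    have := (Measure.quasiMeasurePreserving_fst (μ := treeLaw)
      (ν := (volume : Measure unitInterval))).ae ae_tendstoUniformly
    filter_upwards [this] with w hw
    exact hw.tendsto_at w.2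
  have hfin : ∀ᵐ w ∂treeLaw.prod (volume : Measure unitInterval), supBound w.1 < ⊤ :=
    (Measure.quasiMeasurePreserving_fst (μ := treeLaw) (ν := (volume : Measure unitInterval))).ae
      (ae_lt_top measurable_supBound lintegral_supBound_ne_top)
  have hint : Integrable (fun w : Chords × unitInterval => (supBound w.1).toReal)
      (treeLaw.prod volume) :=
    (integrable_toReal_of_lintegral_ne_top measurable_supBound.aemeasurable
      lintegral_supBound_ne_top).comp_fst _
  have hlim := tendsto_integral_of_dominated_convergence
    (F := fun n (w : Chords × unitInterval) => (approx w.1 n []).1 w.2)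
    (fun w : Chords × unitInterval => (supBound w.1).toReal)
    (fun n => (measurable_eval_prod (measurable_approx n [])).aestronglyMeasurable) hint
    (fun n => by
      filter_upwards [hfin] with w hw
      have := (enorm_le_supNorm _ w.2).trans (supNorm_approx_le w.1 n)
      rw [← toReal_enorm]
      exact ENNReal.toReal_mono hw.ne this) hae
  have hconst : ∀ n, ∫ w : Chords × unitInterval, (approx w.1 n []).1 w.2
      ∂treeLaw.prod volume = κ * betaFn (β + 1) (β + 1) := fun n => by
    rw [← evalMean_approxLaw n, approxLaw, evalMean_map _ (measurable_approx n [])]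
  simp only [hconst] at hlim
  rw [limitLaw, evalMean_map _ measurable_limitPath]
  exact tendsto_nhds_unique hlim tendsto_const_nhds

lemma tendstoUniformly_glue {F G : ℕ → CadlagPath} {f g : CadlagPath}
    (hF : TendstoUniformly (fun n => (F n).1) f.1 atTop)
    (hG : TendstoUniformly (fun n => (G n).1) g.1 atTop) {p : unitInterval × unitInterval}
    (hp : p.1 ≤ p.2) :
    TendstoUniformly (fun n => (glue p (F n) (G n)).1) (glue p f g).1 atTop := by
  rw [tendstoUniformly_iff_supNorm] at hF hG ⊢
  refine tendsto_of_tendsto_of_tendsto_of_le_of_le tendsto_const_nhds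
    (by simpa using hF.add hG) (fun n => zero_le) fun n => ?_
  rw [← glue_diff]
  have hg : (p.2 : ℝ) - p.1 = gap p := (coe_gap hp).symm
  have hea : ∀ r : ℝ, ‖(1 - (gap p : ℝ)) ^ β * r‖ₑ ≤ ‖r‖ₑ := fun r => by
    rw [enorm_mul, Real.enorm_eq_ofReal (one_sub_rpow_β_nonneg _)]
    exact mul_le_of_le_one_left' (ENNReal.ofReal_le_one.2 (one_sub_rpow_β_le_one _))
  have heb : ∀ r : ℝ, ‖(gap p : ℝ) ^ β * r‖ₑ ≤ ‖r‖ₑ := fun r => by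
    rw [enorm_mul, Real.enorm_eq_ofReal (rpow_β_nonneg _)]
    exact mul_le_of_le_one_left' (ENNReal.ofReal_le_one.2 (rpow_β_le_one _))
  refine iSup_le fun s => ?_
  simp only [glue, glueFun]
  rw [hg]
  split_ifs
  · exact ((hea _).trans (enorm_le_supNorm _ _)).trans le_self_add
  · exact (enorm_add_le _ _).trans (add_le_add ((hea _).trans (enorm_le_supNorm _ _))
      ((heb _).trans (enorm_le_supNorm _ _)))
  · exact ((hea _).trans (enorm_le_supNorm _ _)).trans le_self_add

lemma limitLaw_fixed : limitLaw = glueLaw limitLaw := by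
  rw [limitLaw, ← map_treeLaw_glue measurable_limitPath]
  refine Measure.map_congr ?_
  filter_upwards [(measurePreserving_subtree false).quasiMeasurePreserving.ae ae_tendstoUniformly,
    (measurePreserving_subtree true).quasiMeasurePreserving.ae ae_tendstoUniformly,
    ae_treeLaw_le] with p h0 h1 hp
  refine limitPath_eq ?_
  have h := tendstoUniformly_glue h0 h1 (hp [])
  intro u hu
  refine eventually_atTop.2 ?_
  obtain ⟨N, hN⟩ := eventually_atTop.1 (h u hu)
  refine ⟨N + 1, fun n hn s => ?_⟩
  obtain ⟨m, rfl⟩ := Nat.exists_eq_add_of_le hn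
  have := hN (N + m) (by omega) s
  rw [show N + 1 + m = N + m + 1 by omega]
  beta_reduce
  rw [approx_succ_root]
  exact this

/-! ### Uniqueness by coupling -/

/-- Gluing of pairs of paths, with a common chord. -/
def glueBoth (w : (unitInterval × unitInterval) × (CadlagPath × CadlagPath) ×
    (CadlagPath × CadlagPath)) : CadlagPath × CadlagPath :=
  (glue w.1 w.2.1.1 w.2.2.1, glue w.1 w.2.1.2 w.2.2.2)

lemma measurable_glueBoth : Measurable glueBoth :=
  (measurable_glue (by fun_prop) (by fun_prop) (by fun_prop)).prodMk
    (measurable_glue (by fun_prop) (by fun_prop) (by fun_prop))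

/-- The couplings of `μ` and `ν` obtained from the independent one by iterated gluing. -/
def coupling (μ ν : Measure CadlagPath) : ℕ → Measure (CadlagPath × CadlagPath)
  | 0 => μ.prod ν
  | n + 1 => (chordLaw.prod ((coupling μ ν n).prod (coupling μ ν n))).map glueBoth

instance (μ ν : Measure CadlagPath) [IsProbabilityMeasure μ] [IsProbabilityMeasure ν] (n : ℕ) :
    IsProbabilityMeasure (coupling μ ν n) := by
  induction n with
  | zero => exact inferInstanceAs (IsProbabilityMeasure (μ.prod ν))
  | succ n ih => exact Measure.isProbabilityMeasure_map measurable_glueBoth.aemeasurable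

lemma map_glueBoth (ρ : Measure (CadlagPath × CadlagPath)) [IsProbabilityMeasure ρ]
    {Y : CadlagPath × CadlagPath → CadlagPath} (hY : Measurable Y)
    (h : ∀ w, Y (glueBoth w) = glue w.1 (Y w.2.1) (Y w.2.2)) :
    ((chordLaw.prod (ρ.prod ρ)).map glueBoth).map Y = glueLaw (ρ.map Y) := by
  have h2 : Measurable (Prod.map Y Y) := hY.prodMap hY
  rw [Measure.map_map hY measurable_glueBoth, glueLaw, Measure.map_prod_map _ _ hY hY]
  conv_rhs => rw [← Measure.map_id (μ := chordLaw)]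
  rw [Measure.map_prod_map _ _ measurable_id h2,
    Measure.map_map measurable_glue_prod (measurable_id.prodMap h2)]
  exact congrArg (Measure.map · _) (funext h)

lemma coupling_fst {μ ν : Measure CadlagPath} [IsProbabilityMeasure μ] [IsProbabilityMeasure ν]
    (hμ : μ = glueLaw μ) (n : ℕ) : (coupling μ ν n).map Prod.fst = μ := by
  induction n with
  | zero => simp [coupling]
  | succ n ih =>
    rw [coupling, map_glueBoth _ measurable_fst fun _ => rfl, ih, ← hμ]

lemma coupling_snd {μ ν : Measure CadlagPath} [IsProbabilityMeasure μ] [IsProbabilityMeasure ν]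
    (hν : ν = glueLaw ν) (n : ℕ) : (coupling μ ν n).map Prod.snd = ν := by
  induction n with
  | zero => simp [coupling]
  | succ n ih =>
    rw [coupling, map_glueBoth _ measurable_snd fun _ => rfl, ih, ← hν]

lemma measurable_diff_prod :
    Measurable fun q : CadlagPath × CadlagPath => diff q.1 q.2 :=
  measurable_diff measurable_fst measurable_snd

lemma tendsto_supSq_coupling {μ ν : Measure CadlagPath} [IsProbabilityMeasure μ]
    [IsProbabilityMeasure ν] (hμ : μ = glueLaw μ) (hν : ν = glueLaw ν)
    (hμ2 : supSq μ ≠ ⊤) (hν2 : supSq ν ≠ ⊤) (hm : evalMean μ = evalMean ν) :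
    Tendsto (fun n => ∫⁻ q, supNorm (diff q.1 q.2) ^ 2 ∂coupling μ ν n) atTop (𝓝 0) := by
  set δ : ℕ → Measure CadlagPath := fun n => (coupling μ ν n).map fun q => diff q.1 q.2 with hδ
  have hprob : ∀ n, IsProbabilityMeasure (δ n) := fun n =>
    Measure.isProbabilityMeasure_map measurable_diff_prod.aemeasurable
  have hstep : ∀ n, δ (n + 1) = glueLaw (δ n) := fun n =>
    map_glueBoth _ measurable_diff_prod fun w => (glue_diff _ _ _ _ _).symm
  have h1 := coupling_fst (ν := ν) hμ 0
  have h2 := coupling_snd (μ := μ) hν 0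
  have hfin : supSq (δ 0) ≠ ⊤ := supSq_diff_ne_top _ measurable_fst measurable_snd
    (by rwa [h1]) (by rwa [h2])
  have h0 : evalMean (δ 0) = 0 := by
    have := evalMean_diff (coupling μ ν 0) measurable_fst measurable_snd
      (by rwa [h1]) (by rwa [h2])
    rw [h1, h2, hm, sub_self] at this
    exact this
  have hlim : Tendsto (fun n => ENNReal.ofReal 0.98 ^ n * energy (δ 0)) atTop (𝓝 0) := by
    have h98 : ENNReal.ofReal 0.98 < 1 := by rw [ENNReal.ofReal_lt_one]; norm_num
    have := ENNReal.Tendsto.mul_const (ENNReal.tendsto_pow_atTop_nhds_zero_of_lt_one h98)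
      (Or.inr (energy_ne_top hfin))
    rwa [zero_mul] at this
  refine tendsto_of_tendsto_of_tendsto_of_le_of_le tendsto_const_nhds hlim
    (fun n => zero_le) fun n => ?_
  rw [← supSq_map _ measurable_diff_prod]
  exact supSq_iterate_le hprob hstep hfin h0 n

lemma ext_of_restrict {μ ν : Measure CadlagPath} [IsFiniteMeasure μ] [IsFiniteMeasure ν]
    (h : ∀ J : Finset unitInterval, μ.map (fun f => J.restrict f.1) =
      ν.map fun f => J.restrict f.1) : μ = ν := by
  have hval : μ.map Subtype.val = ν.map Subtype.val := by
    have hproj : ∀ ρ : Measure CadlagPath, IsProjectiveLimit (ρ.map Subtype.val)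
        fun J : Finset unitInterval => ρ.map fun f => J.restrict f.1 := fun ρ J => by
      rw [Measure.map_map (Finset.measurable_restrict J) measurable_subtype_coe]
      rfl
    have hμ := hproj μ
    simp only [h] at hμ
    have : ∀ J : Finset unitInterval, IsFiniteMeasure (ν.map fun f => J.restrict f.1) :=
      fun J => inferInstance
    exact hμ.unique (hproj ν)
  ext s hs
  obtain ⟨t, ht, rfl⟩ := hs
  rw [← Measure.map_apply measurable_subtype_coe ht, hval,
    Measure.map_apply measurable_subtype_coe ht]

lemma enorm_exp_sub_exp_le (x y : ℝ) :
    ‖Complex.exp (x * Complex.I) - Complex.exp (y * Complex.I)‖ₑ ≤ ‖x - y‖ₑ := by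
  have h : Complex.exp (x * Complex.I) - Complex.exp (y * Complex.I) =
      Complex.exp (y * Complex.I) * (Complex.exp (Complex.I * ((x - y : ℝ) : ℂ)) - 1) := by
    rw [mul_sub, ← Complex.exp_add, mul_one]
    congr 2
    push_cast
    ring
  have h1 : ‖Complex.exp (y * Complex.I)‖ₑ = 1 := by
    rw [← ofReal_norm, Complex.norm_exp_ofReal_mul_I, ENNReal.ofReal_one]
  rw [h, enorm_mul, h1, one_mul]
  exact Real.enorm_exp_I_mul_ofReal_sub_one_le

/-- Two laws that admit couplings with arbitrarily small expected distance are equal. -/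
lemma eq_of_coupling {μ ν : Measure CadlagPath} [IsProbabilityMeasure μ] [IsProbabilityMeasure ν]
    {ρ : ℕ → Measure (CadlagPath × CadlagPath)} (hρ : ∀ n, IsProbabilityMeasure (ρ n))
    (h1 : ∀ n, (ρ n).map Prod.fst = μ) (h2 : ∀ n, (ρ n).map Prod.snd = ν)
    (h : Tendsto (fun n => ∫⁻ q, supNorm (diff q.1 q.2) ^ 2 ∂ρ n) atTop (𝓝 0)) : μ = ν := by
  refine ext_of_restrict fun J => ?_
  have hJ : Measurable fun f : CadlagPath => J.restrict f.1 :=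
    (Finset.measurable_restrict J).comp measurable_subtype_coe
  have : IsFiniteMeasure (μ.map fun f => J.restrict f.1) := inferInstance
  have : IsFiniteMeasure (ν.map fun f => J.restrict f.1) := inferInstance
  refine Measure.ext_of_charFunDual (funext fun L => ?_)
  set φ : CadlagPath → ℂ := fun f => Complex.exp (L (J.restrict f.1) * Complex.I) with hφ
  have hφm : Measurable φ := by
    have : Measurable fun f : CadlagPath => L (J.restrict f.1) := L.measurable.comp hJ
    fun_prop
  have hnorm : ∀ f, ‖φ f‖ ≤ 1 := fun f => (Complex.norm_exp_ofReal_mul_I _).le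
  have hchar : ∀ θ : Measure CadlagPath,
      charFunDual (θ.map fun f => J.restrict f.1) L = ∫ f, φ f ∂θ := fun θ => by
    rw [charFunDual_apply, integral_map hJ.aemeasurable (by fun_prop)]
  have hlip : ∀ f g, ‖φ f - φ g‖ₑ ≤ ‖L‖ₑ * supNorm (diff f g) := fun f g => by
    refine (enorm_exp_sub_exp_le _ _).trans ?_
    rw [← map_sub]
    refine (L.le_opENorm _).trans ?_
    gcongr
    rw [← edist_zero_right, edist_pi_le_iff]
    intro s
    rw [Pi.zero_apply, edist_zero_right]
    exact enorm_le_supNorm (diff f g) s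
  have hbound : ∀ n, ‖(∫ f, φ f ∂μ) - ∫ f, φ f ∂ν‖ₑ ≤
      ‖L‖ₑ * ∫⁻ q, supNorm (diff q.1 q.2) ∂ρ n := fun n => by
    have hi : ∀ {Y : CadlagPath × CadlagPath → CadlagPath}, Measurable Y →
        Integrable (fun q => φ (Y q)) (ρ n) := fun hY =>
      Integrable.of_bound (hφm.comp hY).aestronglyMeasurable 1
        (Eventually.of_forall fun q => hnorm _)
    rw [← h1 n, ← h2 n, integral_map measurable_fst.aemeasurable hφm.aestronglyMeasurable,
      integral_map measurable_snd.aemeasurable hφm.aestronglyMeasurable,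
      ← integral_sub (hi measurable_fst) (hi measurable_snd),
      ← lintegral_const_mul' _ _ enorm_ne_top]
    exact (enorm_integral_le_lintegral_enorm _).trans (lintegral_mono fun q => hlip _ _)
  rw [hchar, hchar, ← sub_eq_zero, ← enorm_eq_zero]
  refine le_antisymm (ge_of_tendsto' (x := atTop) ?_ hbound) zero_le
  have hzero : Tendsto (fun n => ∫⁻ q, supNorm (diff q.1 q.2) ∂ρ n) atTop (𝓝 0) := by
    refine ENNReal.tendsto_nhds_zero.2 fun ε hε => ?_
    rcases eq_or_ne ε ⊤ with rfl | hεt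
    · exact Eventually.of_forall fun n => le_top
    have hε2 : ε / 2 ≠ 0 := (ENNReal.half_pos hε.ne').ne'
    have hε2t : ε / 2 ≠ ⊤ := (ENNReal.div_lt_top hεt two_ne_zero).ne
    have hpt : ∀ x : ENNReal, x ≤ ε / 2 + (ε / 2)⁻¹ * x ^ 2 := fun x => by
      rcases le_total x (ε / 2) with hx | hx
      · exact hx.trans le_self_add
      · refine le_trans ?_ le_add_self
        calc x = (ε / 2)⁻¹ * (ε / 2 * x) := by
              rw [← mul_assoc, ENNReal.inv_mul_cancel hε2 hε2t, one_mul]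
          _ ≤ (ε / 2)⁻¹ * x ^ 2 := by rw [sq]; gcongr
    have hlim := ENNReal.Tendsto.const_mul (a := (ε / 2)⁻¹) h
      (Or.inr (ENNReal.inv_ne_top.2 hε2))
    rw [mul_zero] at hlim
    filter_upwards [ENNReal.tendsto_nhds_zero.1 hlim _ (ENNReal.half_pos hε.ne')] with n hn
    refine (lintegral_mono fun q => hpt _).trans ?_
    rw [lintegral_add_left measurable_const, lintegral_const, measure_univ, mul_one,
      lintegral_const_mul' _ _ (ENNReal.inv_ne_top.2 hε2)]
    exact (add_le_add le_rfl hn).trans_eq (ENNReal.add_halves ε)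
  have := ENNReal.Tendsto.const_mul (a := ‖L‖ₑ) hzero (Or.inr enorm_ne_top)
  rwa [mul_zero] at this

/-- Two solutions of the fixed-point equation with the same mean have the same law. -/
lemma eq_of_fixed {μ ν : Measure CadlagPath} [IsProbabilityMeasure μ]
    [IsProbabilityMeasure ν] (hμ : μ = glueLaw μ) (hν : ν = glueLaw ν)
    (hμ2 : supSq μ ≠ ⊤) (hν2 : supSq ν ≠ ⊤) (hm : evalMean μ = evalMean ν) : μ = ν :=
  eq_of_coupling (fun _ => inferInstance) (coupling_fst hμ) (coupling_snd hν)
    (tendsto_supSq_coupling hμ hν hμ2 hν2 hm)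

instance : IsProbabilityMeasure limitLaw :=
  Measure.isProbabilityMeasure_map measurable_limitPath.aemeasurable

lemma map_chords_eq_treeLaw {Ω : Type*} [MeasurableSpace Ω] {P : Measure Ω}
    {UV : List Bool → Ω → unitInterval × unitInterval} (hUV_meas : ∀ w, Measurable (UV w))
    (hUV_indep : iIndepFun UV P) (hUV_law : ∀ w, P.map (UV w) = chordLaw) :
    P.map (fun ω w => UV w ω) = treeLaw := by
  rw [hUV_indep.map_fun_eq_infinitePi_map hUV_meas]
  simp only [hUV_law]
  rfl

lemma isSolution_iff {Ω : Type*} [MeasurableSpace Ω] (P : Measure Ω) [IsProbabilityMeasure P]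
    (X : Ω → CadlagPath) :
    IsSolution P X ↔ Measurable X ∧ P.map X = glueLaw (P.map X) ∧
      evalMean (P.map X) = κ * betaFn (β + 1) (β + 1) ∧ supSq (P.map X) ≠ ⊤ := by
  constructor
  · rintro ⟨h1, h2, h3, h4⟩
    refine ⟨h1, h2, by rwa [evalMean_map P h1], ?_⟩
    rw [supSq_map P h1]
    exact h4.ne
  · rintro ⟨h1, h2, h3, h4⟩
    rw [evalMean_map P h1] at h3
    rw [supSq_map P h1] at h4
    exact ⟨h1, h2, h3, lt_top_iff_ne_top.2 h4⟩

end ChordTree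

end

theorem mainTheorem8 {Ω : Type*} [MeasurableSpace Ω] (P : Measure Ω)
    [IsProbabilityMeasure P]
    (UV : List Bool → Ω → unitInterval × unitInterval)
    (hUV_meas : ∀ w, Measurable (UV w))
    (hUV_indep : iIndepFun UV P)
    (hUV_law : ∀ w, P.map (UV w) = ChordTree.chordLaw) :
    let Z : Ω → ChordTree.CadlagPath := fun ω => ChordTree.limitPath (fun w => UV w ω)
    (∀ᵐ ω ∂P,
      TendstoUniformly (fun n => (ChordTree.approx (fun w => UV w ω) n []).1) (Z ω).1 atTop ∧
        Continuous (Z ω).1) ∧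
    ChordTree.IsSolution P Z ∧
    ∀ (Ω' : Type*) [MeasurableSpace Ω'] (P' : Measure Ω') [IsProbabilityMeasure P']
      (X : Ω' → ChordTree.CadlagPath),
      ChordTree.IsSolution P' X → P'.map X = P.map Z := by
  have hmeas : Measurable fun ω w => UV w ω := measurable_pi_iff.2 hUV_meas
  have hlaw := ChordTree.map_chords_eq_treeLaw hUV_meas hUV_indep hUV_law
  intro Z
  have hZlaw : P.map Z = ChordTree.limitLaw := by
    rw [ChordTree.limitLaw, ← hlaw, Measure.map_map ChordTree.measurable_limitPath hmeas]
    rfl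
  have hZ : ChordTree.IsSolution P Z := by
    rw [ChordTree.isSolution_iff, hZlaw]
    exact ⟨ChordTree.measurable_limitPath.comp hmeas, ChordTree.limitLaw_fixed,
      ChordTree.evalMean_limitLaw, ChordTree.supSq_limitLaw_ne_top⟩
  refine ⟨?_, hZ, fun Ω' _ P' _ X hX => ?_⟩
  · have h1 := ChordTree.ae_tendstoUniformly
    have h2 := ChordTree.ae_continuous_limitPath
    rw [← hlaw] at h1 h2
    filter_upwards [ae_of_ae_map hmeas.aemeasurable h1, ae_of_ae_map hmeas.aemeasurable h2]
      with ω hω1 hω2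
    exact ⟨hω1, hω2⟩
  · obtain ⟨hX1, hX2, hX3, hX4⟩ := (ChordTree.isSolution_iff P' X).1 hX
    have : IsProbabilityMeasure (P'.map X) := Measure.isProbabilityMeasure_map hX1.aemeasurable
    rw [hZlaw]
    exact ChordTree.eq_of_fixed hX2 ChordTree.limitLaw_fixed hX4
      ChordTree.supSq_limitLaw_ne_top (hX3.trans ChordTree.evalMean_limitLaw.symm)
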